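/- For non-negative integers $N, M$, integers $s_1,\dots,s_k$ ($k\ge 0$) and a prime $p$ put $$S_{N,M}(s_1,\dots,s_k)=\sum_{N\ge n_1>\dots>n_k\ge M+1}\frac1{n_1^{s_1}\cdots n_k^{s_k}},\qquad S^{(p)}_{N,M}(s_1,\dots,s_k)=\sum_{\substack{N\ge n_1>\dots>n_k\ge M+1\\ p\,\nmid\, n_1\cdots n_k}}\frac1{n_1^{s_1}\cdots n_k^{s_k}}.$$ A composition is a finite (possibly empty) list $\mathbf s=(s_1,\dots,s_k)$ of positive integers; write $H_N(\mathbf s)=S_{N,0}(\mathbf s)$ (so $H_N(\emptyset)=1$). Let $\mathbb Q_{p\to\infty}$ be the $\mathbb Q$-algebra of all $(a_p)\in\prod_p\mathbb Q_p$ ($p$ running over the primes) with $v_p(a_p)$ bounded below, modulo the ideal of all $(a_p)$ with $v_p(a_p)\to\infty$ as $p\to\infty$, with the topology in which the subgroups $\{(a_p): a_p\in p^n\mathbb Z_p\text{ for all but finitely many }p\}$, $n\in\mathbb Z$, form a neighbourhood basis of $0$. The MHS algebra $\mathcal M\subset\mathbb Q_{p\to\infty}$ is the set of all elements that have an expansion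 $$(a_p)=\sum_{i=1}^\infty \bigl(c_i\,p^{b_i}H_{p-1}(\mathbf s_i)\bigr)_p$$ with $c_i\in\mathbb Q$, integers $b_i\to\infty$ and compositions $\mathbf s_i$, all independent of $p$. For $n\in\mathbb Z$, $\mathrm{Fil}^n\mathcal M$ is the set of those elements that have such an expansion with $b_i\ge n$ for all $i$. **Theorem.** Let $s_1,\dots,s_k$ be arbitrary integers and let $f,g\in\mathbb Z[x]$ have positive leading coefficients. Then $$S_{f(p),g(p)}(s_1,\dots,s_k)\in\mathrm{Fil}^{-\deg(f)\left([s_1]^++\dots+[s_k]^+\right)}\mathcal M,\qquad S^{(p)}_{f(p),g(p)}(s_1,\dots,s_k)\in\mathrm{Fil}^0\mathcal M,$$ where $[n]^+=\max(n,0)$ (the finitely many primes $p$ with $f(p)<0$ or $g(p)<0$ are irrelevant). Moreover, for every $f\in\mathbb Z[x]$ with positive leading coefficient and every composition $\mathbf s$, the multiple harmonic sum $H_{f(p)}(\mathbf s)$ is in the MHS algebra $\mathcal M$. -/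

import Mathlib

namespace MHS

noncomputable section

instance primesFact (p : Nat.Primes) : Fact (p : ℕ).Prime := ⟨p.2⟩

/-- `x ∈ p ^ n ℤ_p`, that is, `v_p(x) ≥ n` (with `v_p(0) = ∞`). -/
def ValGE (p : Nat.Primes) (n : ℤ) (x : ℚ_[p]) : Prop :=
  ‖x‖ ≤ ((p : ℕ) : ℝ) ^ (-n)

theorem one_le_prime (p : Nat.Primes) : (1 : ℝ) ≤ ((p : ℕ) : ℝ) := by
  exact_mod_cast p.2.one_lt.le

theorem prime_pos (p : Nat.Primes) : (0 : ℝ) < ((p : ℕ) : ℝ) :=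
  lt_of_lt_of_le one_pos (one_le_prime p)

theorem ValGE.mono {p : Nat.Primes} {m n : ℤ} {x : ℚ_[p]} (h : ValGE p n x) (hmn : m ≤ n) :
    ValGE p m x :=
  le_trans h (zpow_le_zpow_right₀ (one_le_prime p) (by omega))

theorem ValGE.zero (p : Nat.Primes) (n : ℤ) : ValGE p n 0 := by
  unfold ValGE
  rw [norm_zero]
  exact (zpow_pos (prime_pos p) _).le

theorem ValGE.add {p : Nat.Primes} {n : ℤ} {x y : ℚ_[p]} (hx : ValGE p n x)
    (hy : ValGE p n y) : ValGE p n (x + y) :=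
  le_trans (Padic.nonarchimedean x y) (max_le hx hy)

theorem ValGE.neg {p : Nat.Primes} {n : ℤ} {x : ℚ_[p]} (hx : ValGE p n x) :
    ValGE p n (-x) := by
  unfold ValGE at *
  rwa [norm_neg]

theorem ValGE.mul {p : Nat.Primes} {m n : ℤ} {x y : ℚ_[p]} (hx : ValGE p m x)
    (hy : ValGE p n y) : ValGE p (m + n) (x * y) := by
  unfold ValGE at *
  rw [norm_mul, neg_add, zpow_add₀ (prime_pos p).ne']
  exact mul_le_mul hx hy (norm_nonneg _) (zpow_pos (prime_pos p) _).le

theorem valGE_rat (c : ℚ) (p : Nat.Primes) : ValGE p (-(c.den : ℤ)) (c : ℚ_[p]) := by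
  unfold ValGE
  have hden : (0 : ℝ) < ‖(c.den : ℚ_[p])‖ := by
    rw [norm_pos_iff]
    exact_mod_cast c.den_nz
  have h1 : ((p : ℕ) : ℝ) ^ (-(c.den : ℤ)) ≤ ‖(c.den : ℚ_[p])‖ := by
    by_contra h
    push Not at h
    have h2 := (Padic.norm_int_le_pow_iff_dvd (p := (p : ℕ)) (c.den : ℤ) c.den).1
      (by exact_mod_cast h.le)
    have h3 : (p : ℕ) ^ c.den ∣ c.den := by exact_mod_cast h2
    exact absurd (Nat.le_of_dvd c.den_pos h3) (not_le.2 (Nat.lt_pow_self p.2.one_lt))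
  have h4 : (c : ℚ_[p]) * (c.den : ℚ_[p]) = (c.num : ℚ_[p]) := by
    exact_mod_cast congrArg (fun q : ℚ => (q : ℚ_[p])) (Rat.mul_den_eq_num c)
  have h5 : ‖(c : ℚ_[p])‖ * ‖(c.den : ℚ_[p])‖ ≤ 1 := by
    rw [← norm_mul, h4]
    exact Padic.norm_int_le_one _
  have h6 : ‖(c : ℚ_[p])‖ * ((p : ℕ) : ℝ) ^ (-(c.den : ℤ)) ≤ 1 :=
    le_trans (mul_le_mul_of_nonneg_left h1 (norm_nonneg _)) h5
  rw [zpow_neg, ← div_eq_mul_inv, div_le_one (zpow_pos (prime_pos p) _)] at h6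
  rwa [neg_neg]

/-- The `ℚ`-algebra of all `(a_p) ∈ ∏_p ℚ_p` with `v_p(a_p)` bounded below. -/
def boundedSeq : Subalgebra ℚ (∀ p : Nat.Primes, ℚ_[p]) where
  carrier := {a | ∃ n : ℤ, ∀ p, ValGE p n (a p)}
  mul_mem' := by
    rintro a b ⟨m, hm⟩ ⟨n, hn⟩
    exact ⟨m + n, fun p => (hm p).mul (hn p)⟩
  add_mem' := by
    rintro a b ⟨m, hm⟩ ⟨n, hn⟩
    exact ⟨min m n, fun p =>
      ((hm p).mono (min_le_left _ _)).add ((hn p).mono (min_le_right _ _))⟩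
  algebraMap_mem' c := ⟨-(c.den : ℤ), fun p => by
    simpa [Pi.algebraMap_apply] using valGE_rat c p⟩

/-- The ideal of all `(a_p)` with `v_p(a_p) → ∞` as `p → ∞`. -/
def nullIdeal : Ideal boundedSeq where
  carrier := {a | ∀ n : ℤ, ∀ᶠ p in Filter.cofinite, ValGE p n (a.1 p)}
  zero_mem' n := Filter.Eventually.of_forall fun p => ValGE.zero p n
  add_mem' := by
    intro a b ha hb n
    filter_upwards [ha n, hb n] with p h1 h2
    exact h1.add h2
  smul_mem' := by
    rintro ⟨c, m, hm⟩ a ha n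
    filter_upwards [ha (n - m)] with p h1
    have h2 := (hm p).mul h1
    rwa [add_sub_cancel] at h2

/-- The ring `ℚ_{p → ∞}`. -/
abbrev QInf : Type := boundedSeq ⧸ nullIdeal

/-- The class in `ℚ_{p → ∞}` of a sequence with `v_p(a_p)` bounded below. -/
def toQInf (a : boundedSeq) : QInf := Ideal.Quotient.mk nullIdeal a

/-- `Fil^n ℚ_{p → ∞}`: the classes of the `(a_p)` with `a_p ∈ p ^ n ℤ_p` for all but finitely
many `p`. These subgroups are a neighbourhood basis of `0`. -/
def filQInf (n : ℤ) : Set QInf :=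
  {x | ∃ a : boundedSeq, toQInf a = x ∧ ∀ᶠ p in Filter.cofinite, ValGE p n (a.1 p)}

/-- The series `∑ u i` converges to `x` in the topology of `ℚ_{p → ∞}`. -/
def ConvergesTo (u : ℕ → QInf) (x : QInf) : Prop :=
  ∀ n : ℤ, ∃ m₀ : ℕ, ∀ m ≥ m₀, x - ∑ i ∈ Finset.range m, u i ∈ filQInf n

/-- The multiple harmonic sum `H_N(s_1, …, s_k)` of a composition `(s_1, …, s_k)`. -/
def harmonicSum (N : ℕ) (s : List ℕ+) : ℚ :=
  ∑ n ∈ Fintype.piFinset (fun _ : Fin s.length => Finset.Icc 1 N) with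
      ∀ i j, i < j → n j < n i,
    1 / ∏ i, (n i : ℚ) ^ (s.get i : ℕ)

/-- The multiple power sum `S_{N,M}(s_1, …, s_k)`. -/
def powerSum {k : ℕ} (N M : ℕ) (s : Fin k → ℤ) : ℚ :=
  ∑ n ∈ Fintype.piFinset (fun _ : Fin k => Finset.Icc (M + 1) N) with
      ∀ i j, i < j → n j < n i,
    1 / ∏ i, (n i : ℚ) ^ s i

/-- The `p`-restricted multiple power sum `S^{(p)}_{N,M}(s_1, …, s_k)`. -/
def powerSumRestricted {k : ℕ} (p N M : ℕ) (s : Fin k → ℤ) : ℚ :=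
  ∑ n ∈ Fintype.piFinset (fun _ : Fin k => Finset.Icc (M + 1) N) with
      (∀ i j, i < j → n j < n i) ∧ ¬ p ∣ ∏ i, n i,
    1 / ∏ i, (n i : ℚ) ^ s i

theorem valGE_harmonicSum (p : Nat.Primes) (s : List ℕ+) :
    ValGE p 0 ((harmonicSum ((p : ℕ) - 1) s : ℚ) : ℚ_[p]) := by
  unfold ValGE harmonicSum
  rw [neg_zero, zpow_zero, Rat.cast_sum]
  refine IsUltrametricDist.norm_sum_le_of_forall_le_of_nonneg zero_le_one ?_
  intro n hn
  rw [Finset.mem_filter, Fintype.mem_piFinset] at hn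
  have h : ∀ i, ‖((n i : ℕ) : ℚ_[p])‖ = 1 := by
    intro i
    have h1 := Finset.mem_Icc.1 (hn.1 i)
    refine le_antisymm (by exact_mod_cast Padic.norm_int_le_one (p := (p : ℕ)) (n i : ℤ)) ?_
    by_contra h2
    push Not at h2
    have h3 := (Padic.norm_intCast_lt_one_iff (p := (p : ℕ)) (k := (n i : ℤ))).1
      (by exact_mod_cast h2)
    have h4 := Nat.le_of_dvd (by omega) (Int.natCast_dvd_natCast.1 h3)
    have := p.2.one_lt
    omega
  push_cast
  rw [norm_div, norm_prod]
  simp [h]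

/-- The element `(p ^ b)_p`. -/
def pPow (b : ℤ) : boundedSeq :=
  ⟨fun p => ((p : ℕ) : ℚ_[p]) ^ b, b, fun p => (Padic.norm_p_zpow b).le⟩

/-- The element `(H_{p-1}(s))_p`. -/
def harmonicSeq (s : List ℕ+) : boundedSeq :=
  ⟨fun p => ((harmonicSum ((p : ℕ) - 1) s : ℚ) : ℚ_[p]), 0, fun p => valGE_harmonicSum p s⟩

/-- `x = ∑ c_i p ^ b_i H_{p-1}(s_i)` in `ℚ_{p → ∞}`, where the integers `b_i` go to infinity. -/
def IsExpansion (c : ℕ → ℚ) (b : ℕ → ℤ) (s : ℕ → List ℕ+) (x : QInf) : Prop :=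
  Filter.Tendsto b Filter.atTop Filter.atTop ∧
    ConvergesTo (fun i => toQInf (c i • (pPow (b i) * harmonicSeq (s i)))) x

/-- The MHS algebra. -/
def mhsAlgebra : Set QInf :=
  {x | ∃ (c : ℕ → ℚ) (b : ℕ → ℤ) (s : ℕ → List ℕ+), IsExpansion c b s x}

/-- The filtration `Fil^n` of the MHS algebra. -/
def filMHS (n : ℤ) : Set QInf :=
  {x | ∃ (c : ℕ → ℚ) (b : ℕ → ℤ) (s : ℕ → List ℕ+), IsExpansion c b s x ∧ ∀ i, n ≤ b i}

/-- The sequence of rational numbers `(a_p)_p` has `v_p(a_p)` bounded below, and its class in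
`ℚ_{p → ∞}` lies in the set `X`. -/
def ClassMem (a : Nat.Primes → ℚ) (X : Set QInf) : Prop :=
  ∃ h : (fun p : Nat.Primes => ((a p : ℚ) : ℚ_[p])) ∈ boundedSeq, toQInf ⟨_, h⟩ ∈ X

/-- The value `f(p)`, as a natural number. If `f` has a positive leading coefficient, then
`f(p) < 0` for finitely many `p` only, and these do not matter in `ℚ_{p → ∞}`. -/
def natEval (f : Polynomial ℤ) (p : ℕ) : ℕ := (f.eval (p : ℤ)).toNat

end

end MHS

/-! The proof is an induction on `deg f`, through nested sums of "letters": powers `n ^ (-s)` with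
arbitrary integer `s`, which may be flagged to vanish at multiples of `p`. The flag lets restricted
and unrestricted sums share one induction.

Write `f = X * F + a`. Passing from `p F(p)` to `p F(p) + a` adds or removes a bounded number of
largest indices, which are values of polynomials at `p`; their powers have expansions by a geometric
series in `p`. Below `p F(p)`, cut the range into blocks `p m + 1, …, p m + p` with `m < F(p)`. The
last number `p (m + 1)` contributes `p ^ (-s) (m + 1) ^ (-s)`. For `0 < i < p` the binomial series
gives `(p m + i) ^ (-s) = ∑ choose(-s, j) p ^ j m ^ j i ^ (-s - j)`, so the nested sum over the
other numbers of a block is a series of terms `C_p m ^ j`, where `C_p` is built from nested sums up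
to `p - 1`. Summing over the blocks leaves series of terms `C_p S_{F(p)}(t)`, to which the induction
hypothesis applies (`wordSum_mem_nestFil`, `wordSum_mul_mem_mhsFil`, `hasExpansions`).

Sums up to `p - 1` with nonpositive exponents reduce to harmonic sums by Faulhaber's formula and
Abel summation (`intSum_mem_polyCompSpan`), and the quasi-shuffle product makes the filtration
multiplicative (`mhsFil_mul`). For the pole order, only multiples of `p` matter: such an index costs
at most one factor `p ^ (-s)` beyond the cost of the corresponding index below `F(p)`, hence `deg f`
per unit of positive exponent, and nothing if flagged. A lower limit `g(p)` is handled by solving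
the formula that splits a sum at `g(p)`.

All convergence arguments take place in filtered spaces of rational families (`completion`); the
passage to `ℚ_{p → ∞}` comes last. -/

namespace MHS

noncomputable section

open Filter

/-! ### Completion of a filtered subspace -/

section Completion

variable {E E' : Type*} [AddCommGroup E] [Module ℚ E] [AddCommGroup E'] [Module ℚ E']

/-- The elements of `E` that are asymptotic sums, with respect to the filtration `V`, of series
whose `j`-th term lies in `B (c + j)`. -/
def completion (V B : ℤ → Submodule ℚ E) (c : ℤ) : Submodule ℚ E where
  carrier := {x | ∃ y : ℕ → E, (∀ j : ℕ, y j ∈ B (c + j)) ∧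
    ∀ J : ℕ, x - ∑ j ∈ Finset.range J, y j ∈ V (c + J)}
  zero_mem' := ⟨0, fun j => zero_mem _, fun J => by simp⟩
  add_mem' := by
    rintro x x' ⟨y, hy, hx⟩ ⟨y', hy', hx'⟩
    refine ⟨y + y', fun j => add_mem (hy j) (hy' j), fun J => ?_⟩
    have := add_mem (hx J) (hx' J)
    simp only [Pi.add_apply, Finset.sum_add_distrib]
    convert this using 1
    abel
  smul_mem' := by
    rintro r x ⟨y, hy, hx⟩
    refine ⟨r • y, fun j => Submodule.smul_mem _ _ (hy j), fun J => ?_⟩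
    have := Submodule.smul_mem _ r (hx J)
    simpa only [Pi.smul_apply, ← Finset.smul_sum, ← smul_sub] using this

variable {V B : ℤ → Submodule ℚ E} {V' B' : ℤ → Submodule ℚ E'}

theorem completion_le (c : ℤ) : completion V B c ≤ V c := by
  rintro x ⟨y, -, hx⟩
  simpa using hx 0

theorem le_completion (hBV : ∀ n, B n ≤ V n) (c : ℤ) : B c ≤ completion V B c := by
  intro x hx
  refine ⟨fun j => if j = 0 then x else 0, fun j => ?_, fun J => ?_⟩
  · rcases j with _ | j
    · simpa using hx
    · simp
  · rcases J with _ | J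
    · simpa using hBV _ hx
    · simp [Finset.sum_ite_eq']

theorem completion_antitone (hV : Antitone V) : Antitone (completion V B) := by
  refine antitone_int_of_succ_le fun c => ?_
  rintro x ⟨y, hy, hx⟩
  refine ⟨fun j => Nat.casesOn j 0 y, fun j => ?_, fun J => ?_⟩
  · rcases j with _ | j
    · simp
    · have := hy j
      simp only [Nat.cast_add, Nat.cast_one]
      convert this using 2
      ring
  · rcases J with _ | J
    · have := hV (show c ≤ c + 1 by omega) (by simpa using hx 0)
      simpa using this
    · rw [Finset.sum_range_succ']
      have := hx J
      simp only [Nat.cast_add, Nat.cast_one]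
      convert this using 2
      · ring
      · exact add_zero _

/-- A double series is regrouped along its diagonals: the `n`-th term collects the pieces `z j (n -
j)`, all of level `c + n`. -/
theorem mem_completion_of_series {c : ℤ} {x : E} (y : ℕ → E)
    (hy : ∀ j : ℕ, y j ∈ completion V B (c + j))
    (hx : ∀ J : ℕ, x - ∑ j ∈ Finset.range J, y j ∈ V (c + J)) : x ∈ completion V B c := by
  choose z hz hyz using hy
  refine ⟨fun n => ∑ j ∈ Finset.range (n + 1), z j (n - j), fun n => ?_, fun J => ?_⟩
  · refine sum_mem fun j hj => ?_
    have h := hz j (n - j)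
    have hj' : j ≤ n := by simpa [Nat.lt_succ_iff] using hj
    convert h using 2
    push_cast [hj']
    ring
  · rw [Finset.sum_range_diag_flip]
    have h1 : x - ∑ j ∈ Finset.range J, ∑ i ∈ Finset.range (J - j), z j i =
        (x - ∑ j ∈ Finset.range J, y j) +
          ∑ j ∈ Finset.range J, (y j - ∑ i ∈ Finset.range (J - j), z j i) := by
      rw [Finset.sum_sub_distrib]
      abel
    rw [h1]
    refine add_mem (hx J) (sum_mem fun j hj => ?_)
    have h := hyz j (J - j)
    have hj' : j ≤ J := (Finset.mem_range.1 hj).le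
    convert h using 2
    push_cast [hj']
    ring

/-- The main tool for transporting expansions: a filtered linear map need only be understood on
basic terms, and their images may themselves be infinite expansions. -/
theorem map_mem_completion (L : E →ₗ[ℚ] E') {a : ℤ}
    (hLV : ∀ n, ∀ x ∈ V n, L x ∈ V' (n + a))
    (hLB : ∀ n, ∀ x ∈ B n, L x ∈ completion V' B' (n + a)) {c : ℤ} {x : E}
    (hx : x ∈ completion V B c) : L x ∈ completion V' B' (c + a) := by
  obtain ⟨y, hy, hxy⟩ := hx
  refine mem_completion_of_series (fun j => L (y j)) (fun j => ?_) fun J => ?_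
  · have := hLB _ _ (hy j)
    rwa [add_right_comm] at this
  · have := hLV _ _ (hxy J)
    rwa [add_right_comm, map_sub, map_sum] at this

/-- A linear map sends a span into a submodule if it does so on generators. -/
theorem map_mem_of_mem_span (L : E →ₗ[ℚ] E') {S : Set E} {P : Submodule ℚ E'}
    (h : ∀ x ∈ S, L x ∈ P) {x : E} (hx : x ∈ Submodule.span ℚ S) : L x ∈ P :=
  (Submodule.span_le (p := P.comap L)).2 h hx

end Completion

/-! ### Valuations of rational numbers -/

/-- `v_p(x) ≥ n` for a rational number `x`. -/
def RatValGE (p : Nat.Primes) (n : ℤ) (x : ℚ) : Prop := ValGE p n (x : ℚ_[p])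

namespace RatValGE

variable {p : Nat.Primes} {m n : ℤ} {x y : ℚ}

theorem mono (h : RatValGE p n x) (hmn : m ≤ n) : RatValGE p m x := ValGE.mono h hmn

theorem zero (p : Nat.Primes) (n : ℤ) : RatValGE p n 0 := by
  simpa [RatValGE] using ValGE.zero p n

theorem add (hx : RatValGE p n x) (hy : RatValGE p n y) : RatValGE p n (x + y) := by
  simpa [RatValGE] using ValGE.add hx hy

theorem neg (hx : RatValGE p n x) : RatValGE p n (-x) := by
  simpa [RatValGE] using ValGE.neg hx

theorem sub (hx : RatValGE p n x) (hy : RatValGE p n y) : RatValGE p n (x - y) := by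
  simpa [sub_eq_add_neg] using hx.add hy.neg

theorem mul (hx : RatValGE p m x) (hy : RatValGE p n y) : RatValGE p (m + n) (x * y) := by
  simpa [RatValGE] using ValGE.mul hx hy

theorem mul_of_integral (hx : RatValGE p 0 x) (hy : RatValGE p n y) : RatValGE p n (x * y) := by
  simpa using hx.mul hy

theorem sum {ι : Type*} {s : Finset ι} {f : ι → ℚ} (h : ∀ i ∈ s, RatValGE p n (f i)) :
    RatValGE p n (∑ i ∈ s, f i) :=
  Finset.sum_induction f (RatValGE p n) (fun _ _ => add) (zero p n) h

theorem int (p : Nat.Primes) (z : ℤ) : RatValGE p 0 (z : ℚ) := by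
  simpa [RatValGE, ValGE] using Padic.norm_int_le_one (p := (p : ℕ)) z

theorem nat (p : Nat.Primes) (k : ℕ) : RatValGE p 0 (k : ℚ) := by
  exact_mod_cast int p k

theorem one (p : Nat.Primes) : RatValGE p 0 1 := by exact_mod_cast int p 1

theorem pow (hx : RatValGE p n x) (k : ℕ) : RatValGE p (k * n) (x ^ k) := by
  induction k with
  | zero => simpa using one p
  | succ k ih =>
    rw [pow_succ]
    convert ih.mul hx using 1
    push_cast
    ring

theorem prime_zpow (p : Nat.Primes) (b : ℤ) : RatValGE p b (((p : ℕ) : ℚ) ^ b) := by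
  simp [RatValGE, ValGE]

end RatValGE

/-- `x` is a `p`-adic unit. -/
def RatUnit (p : Nat.Primes) (x : ℚ) : Prop := ‖(x : ℚ_[p])‖ = 1

namespace RatUnit

variable {p : Nat.Primes} {x y : ℚ}

theorem ne_zero (hx : RatUnit p x) : x ≠ 0 := by
  rintro rfl
  simp [RatUnit] at hx

theorem zpow (hx : RatUnit p x) (k : ℤ) : RatUnit p (x ^ k) := by
  unfold RatUnit at *
  rw [Rat.cast_zpow, norm_zpow, hx, one_zpow]

theorem inv (hx : RatUnit p x) : RatUnit p x⁻¹ := by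
  simpa using hx.zpow (-1)

theorem valGE (hx : RatUnit p x) : RatValGE p 0 x := by
  unfold RatUnit at hx
  simp [RatValGE, ValGE, hx]

theorem of_int {z : ℤ} (h : ¬ ((p : ℕ) : ℤ) ∣ z) : RatUnit p (z : ℚ) := by
  refine le_antisymm (by simpa using Padic.norm_int_le_one (p := (p : ℕ)) z) ?_
  by_contra h2
  push Not at h2
  exact h ((Padic.norm_intCast_lt_one_iff (p := (p : ℕ)) (k := z)).1 (by simpa using h2))

theorem of_nat {k : ℕ} (h : ¬ (p : ℕ) ∣ k) : RatUnit p (k : ℚ) := by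
  have := of_int (p := p) (z := (k : ℤ)) (by exact_mod_cast h)
  exact_mod_cast this

end RatUnit

theorem eventually_prime_gt (k : ℕ) : ∀ᶠ p : Nat.Primes in cofinite, k < (p : ℕ) := by
  have h : Tendsto (fun p : Nat.Primes => (p : ℕ)) cofinite cofinite :=
    Subtype.val_injective.tendsto_cofinite
  rw [Nat.cofinite_eq_atTop] at h
  exact h.eventually_gt_atTop k

theorem eventually_not_dvd {z : ℤ} (hz : z ≠ 0) :
    ∀ᶠ p : Nat.Primes in cofinite, ¬ ((p : ℕ) : ℤ) ∣ z := by
  filter_upwards [eventually_prime_gt z.natAbs] with p hp h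
  exact absurd (Nat.le_of_dvd (Int.natAbs_pos.2 hz) (Int.natCast_dvd.1 h)) (by omega)

theorem eventually_rat_integral (c : ℚ) : ∀ᶠ p : Nat.Primes in cofinite, RatValGE p 0 c := by
  filter_upwards [eventually_not_dvd (z := c.den) (by exact_mod_cast c.den_nz)] with p hp
  have h := (RatValGE.int p c.num).mul (RatUnit.of_int hp).inv.valGE
  have h2 : (c.num : ℚ) * ((c.den : ℤ) : ℚ)⁻¹ = c := by
    rw [← div_eq_mul_inv]
    exact_mod_cast Rat.num_div_den c
  rwa [h2] at h

/-! ### Filtrations on families of rational numbers -/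

/-- The families `Φ p i` such that, for almost all `p`, all `Φ p i` with `i ∈ A p` have `p`-adic
valuation at least `n`. -/
def familyFil {I : Type*} (A : Nat.Primes → Set I) (n : ℤ) :
    Submodule ℚ (Nat.Primes → I → ℚ) where
  carrier := {Φ | ∀ᶠ p in cofinite, ∀ i ∈ A p, RatValGE p n (Φ p i)}
  zero_mem' := by
    refine Set.mem_ofPred.2 (Eventually.of_forall fun p i _ => RatValGE.zero p n)
  add_mem' := by
    intro a b ha hb
    rw [Set.mem_ofPred] at *
    filter_upwards [ha, hb] with p h1 h2 i hi
    exact (h1 i hi).add (h2 i hi)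
  smul_mem' := by
    intro c a ha
    rw [Set.mem_ofPred] at *
    filter_upwards [ha, eventually_rat_integral c] with p h1 h2 i hi
    exact h2.mul_of_integral (h1 i hi)

theorem mem_familyFil {I : Type*} {A : Nat.Primes → Set I} {n : ℤ} {Φ : Nat.Primes → I → ℚ} :
    Φ ∈ familyFil A n ↔ ∀ᶠ p in cofinite, ∀ i ∈ A p, RatValGE p n (Φ p i) := Iff.rfl

theorem familyFil_antitone {I : Type*} (A : Nat.Primes → Set I) : Antitone (familyFil A) := by
  intro m n hmn Φ hΦ
  rw [mem_familyFil] at *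
  filter_upwards [hΦ] with p h i hi
  exact (h i hi).mono hmn

/-- The sequences `(a_p)` with `v_p(a_p) ≥ n` for almost all `p`. -/
def seqFil (n : ℤ) : Submodule ℚ (Nat.Primes → ℚ) where
  carrier := {a | ∀ᶠ p in cofinite, RatValGE p n (a p)}
  zero_mem' := Set.mem_ofPred.2 (Eventually.of_forall fun p => RatValGE.zero p n)
  add_mem' := by
    intro a b ha hb
    rw [Set.mem_ofPred] at *
    filter_upwards [ha, hb] with p h1 h2
    exact h1.add h2
  smul_mem' := by
    intro c a ha
    rw [Set.mem_ofPred] at *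
    filter_upwards [ha, eventually_rat_integral c] with p h1 h2
    exact h2.mul_of_integral h1

theorem mem_seqFil {n : ℤ} {a : Nat.Primes → ℚ} :
    a ∈ seqFil n ↔ ∀ᶠ p in cofinite, RatValGE p n (a p) := Iff.rfl

theorem seqFil_antitone : Antitone seqFil := by
  intro m n hmn a ha
  rw [mem_seqFil] at *
  filter_upwards [ha] with p h
  exact h.mono hmn

/-! ### Nested sums -/

/-- The nested sum of `φ₁ n₁ ⋯ φₖ nₖ` over `N ≥ n₁ > ⋯ > nₖ ≥ 1`. -/
def chainSum : List (ℕ → ℚ) → ℕ → ℚ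
  | [], _ => 1
  | φ :: w, N => ∑ n ∈ Finset.range N, φ (n + 1) * chainSum w n

theorem chainSum_cons (φ : ℕ → ℚ) (w : List (ℕ → ℚ)) (N : ℕ) :
    chainSum (φ :: w) N = ∑ n ∈ Finset.range N, φ (n + 1) * chainSum w n := rfl

theorem chainSum_cons_succ (φ : ℕ → ℚ) (w : List (ℕ → ℚ)) (N : ℕ) :
    chainSum (φ :: w) (N + 1) = chainSum (φ :: w) N + φ (N + 1) * chainSum w N := by
  rw [chainSum_cons, Finset.sum_range_succ, chainSum_cons]

/-- The nested sum of `n₁ ^ (-s₁) ⋯ nₖ ^ (-sₖ)` over `N ≥ n₁ > ⋯ > nₖ ≥ 1`. -/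
def intSum (t : List ℤ) (N : ℕ) : ℚ := chainSum (t.map fun s n => (n : ℚ) ^ (-s)) N

theorem intSum_nil (N : ℕ) : intSum [] N = 1 := rfl

theorem intSum_cons (s : ℤ) (t : List ℤ) (N : ℕ) :
    intSum (s :: t) N = ∑ n ∈ Finset.range N, ((n : ℚ) + 1) ^ (-s) * intSum t n := by
  simp [intSum, chainSum_cons]

/-- A composition as a list of integers. -/
def compList (t : List ℕ+) : List ℤ := List.map (fun s : ℕ+ => ((s : ℕ) : ℤ)) t

theorem compList_nil : compList [] = [] := rfl

theorem compList_cons (s : ℕ+) (t : List ℕ+) : compList (s :: t) = ((s : ℕ) : ℤ) :: compList t :=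
  rfl

/-- Weighted summation `Φ ↦ ∑_{n < N} ψ(n) Φ(n)`. -/
def sumOp (ψ : ℕ → ℚ) : (ℕ → ℚ) →ₗ[ℚ] (ℕ → ℚ) where
  toFun Φ N := ∑ n ∈ Finset.range N, ψ n * Φ n
  map_add' Φ Φ' := by
    ext N
    simp [mul_add, Finset.sum_add_distrib]
  map_smul' c Φ := by
    ext N
    simp [Finset.mul_sum, mul_left_comm]

theorem sumOp_apply (ψ Φ : ℕ → ℚ) (N : ℕ) :
    sumOp ψ Φ N = ∑ n ∈ Finset.range N, ψ n * Φ n := rfl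

/-- The weight `n ↦ (n + 1) ^ (-s)`. -/
def powWeight (s : ℤ) (n : ℕ) : ℚ := ((n : ℚ) + 1) ^ (-s)

theorem intSum_cons_eq (s : ℤ) (t : List ℤ) : intSum (s :: t) = sumOp (powWeight s) (intSum t) := by
  ext N
  rw [intSum_cons, sumOp_apply]
  rfl

/-- The span of the multiple harmonic sums, as functions of the upper limit. -/
def compSpan : Submodule ℚ (ℕ → ℚ) :=
  Submodule.span ℚ (Set.range fun t : List ℕ+ => intSum (compList t))

theorem intSum_mem_compSpan (t : List ℕ+) : intSum (compList t) ∈ compSpan :=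
  Submodule.subset_span ⟨t, rfl⟩

theorem sumOp_mem_compSpan (s : ℕ+) {Φ : ℕ → ℚ} (h : Φ ∈ compSpan) :
    sumOp (powWeight (s : ℕ)) Φ ∈ compSpan := by
  refine map_mem_of_mem_span _ ?_ h
  rintro _ ⟨t, rfl⟩
  refine Submodule.subset_span ⟨s :: t, ?_⟩
  simp only [compList_cons, intSum_cons_eq]

/-- The three terms correspond to the largest index of the first factor being greater than, less
than or equal to that of the second. -/
theorem quasiShuffle (a b : ℤ) (u v : List ℤ) :
    intSum (a :: u) * intSum (b :: v) =
      sumOp (powWeight a) (intSum u * intSum (b :: v)) +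
        sumOp (powWeight b) (intSum (a :: u) * intSum v) +
          sumOp (powWeight (a + b)) (intSum u * intSum v) := by
  ext N
  simp only [Pi.mul_apply, Pi.add_apply, sumOp_apply, powWeight]
  induction N with
  | zero => simp [intSum_cons]
  | succ N ih =>
    rw [Finset.sum_range_succ, Finset.sum_range_succ, Finset.sum_range_succ]
    have h : ∀ (s : ℤ) (t : List ℤ), intSum (s :: t) (N + 1) =
        intSum (s :: t) N + ((N : ℚ) + 1) ^ (-s) * intSum t N := by
      intro s t
      rw [intSum_cons, Finset.sum_range_succ, intSum_cons]
    have h0 : ((N : ℚ) + 1) ≠ 0 := by positivity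
    have h1 : ((N : ℚ) + 1) ^ (-(a + b)) = ((N : ℚ) + 1) ^ (-a) * ((N : ℚ) + 1) ^ (-b) := by
      rw [neg_add, zpow_add₀ h0]
    rw [h, h, h1]
    linear_combination ih

theorem intSum_mul_mem_compSpan (u v : List ℕ+) :
    intSum (compList u) * intSum (compList v) ∈ compSpan := by
  have h1 : ∀ v : List ℕ+, intSum (compList []) * intSum (compList v) = intSum (compList v) := by
    intro v
    ext N
    simp [compList, intSum_nil]
  induction u generalizing v with
  | nil => rw [h1]; exact intSum_mem_compSpan v
  | cons a u ihu =>
    induction v with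
    | nil => rw [mul_comm, h1]; exact intSum_mem_compSpan _
    | cons b v ihv =>
      rw [compList_cons, compList_cons, quasiShuffle]
      refine add_mem (add_mem (sumOp_mem_compSpan a (ihu (b :: v))) (sumOp_mem_compSpan b ihv)) ?_
      have := sumOp_mem_compSpan (a + b) (ihu v)
      simpa using this

/-! ### Nested sums with arbitrary integer exponents -/

/-- The span of the functions `m ↦ m ^ j H_m(t)`. -/
def polyCompSpan : Submodule ℚ (ℕ → ℚ) :=
  Submodule.span ℚ (Set.range fun x : ℕ × List ℕ+ => fun m : ℕ =>
    (m : ℚ) ^ x.1 * intSum (compList x.2) m)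

theorem mem_polyCompSpan (j : ℕ) (t : List ℕ+) :
    (fun m : ℕ => (m : ℚ) ^ j * intSum (compList t) m) ∈ polyCompSpan :=
  Submodule.subset_span ⟨(j, t), rfl⟩

theorem exists_sum_pow_eq (i : ℕ) : ∃ c : ℕ → ℚ, ∀ m : ℕ,
    ∑ n ∈ Finset.range m, ((n : ℚ) + 1) ^ i =
      ∑ k ∈ Finset.range (i + 1), c k * (m : ℚ) ^ (i + 1 - k) := by
  refine ⟨fun k => bernoulli' k * (i + 1).choose k / (i + 1), fun m => ?_⟩
  have h := sum_Ico_pow m i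
  rw [Finset.sum_Ico_eq_sum_range] at h
  simp only [Nat.add_sub_cancel, Nat.cast_add, Nat.cast_one] at h
  simp only [add_comm (1 : ℚ)] at h
  rw [h]
  refine Finset.sum_congr rfl fun k _ => ?_
  ring

theorem sumOp_comp_mem_polyCompSpan_of_pos (t : List ℕ+) {e : ℤ} (he : 0 < e) :
    sumOp (powWeight e) (intSum (compList t)) ∈ polyCompSpan := by
  obtain ⟨s, rfl⟩ : ∃ s : ℕ+, ((s : ℕ) : ℤ) = e :=
    ⟨Nat.toPNat e.toNat (by omega), Int.toNat_of_nonneg he.le⟩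
  rw [← intSum_cons_eq, ← compList_cons]
  simpa using mem_polyCompSpan 0 (s :: t)

/-- Abel summation with `P(m) = ∑_{n < m} (n + 1) ^ i`, a polynomial in `m`: the boundary term is
`P(m) S_m(s :: t)`, and the increments `(n + 1) ^ (-s) S_n(t)` get the weight `P(n + 1)`, leaving
sums over the shorter list `t`. -/
theorem summation_by_parts (i : ℕ) (c : ℕ → ℚ) (hc : ∀ m : ℕ,
    ∑ n ∈ Finset.range m, ((n : ℚ) + 1) ^ i =
      ∑ k ∈ Finset.range (i + 1), c k * (m : ℚ) ^ (i + 1 - k)) (s : ℤ) (t : List ℤ) :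
    sumOp (powWeight (-i)) (intSum (s :: t)) =
      (∑ k ∈ Finset.range (i + 1), c k •
        fun m : ℕ => (m : ℚ) ^ (i + 1 - k) * intSum (s :: t) m) -
      ∑ k ∈ Finset.range (i + 1), c k •
        sumOp (powWeight (s - (i + 1 - k : ℕ))) (intSum t) := by
  ext m
  simp only [Pi.sub_apply, Finset.sum_apply, Pi.smul_apply, smul_eq_mul]
  simp only [← mul_assoc, ← Finset.sum_mul, ← hc]
  simp only [sumOp_apply, powWeight, neg_neg, zpow_natCast]
  induction m with
  | zero => simp
  | succ m ihm =>
    have h0 : ((m : ℚ) + 1) ≠ 0 := by positivity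
    have h1 : ∀ k : ℕ, ((m : ℚ) + 1) ^ (-(s - (i + 1 - k : ℕ) : ℤ)) =
        ((m : ℚ) + 1) ^ (i + 1 - k) * ((m : ℚ) + 1) ^ (-s) := by
      intro k
      rw [← zpow_natCast, ← zpow_add₀ h0]
      congr 1
      ring
    have h2 := hc (m + 1)
    rw [Finset.sum_range_succ] at h2
    push_cast at h2
    have h3 : intSum (s :: t) (m + 1) =
        intSum (s :: t) m + ((m : ℚ) + 1) ^ (-s) * intSum t m := by
      rw [intSum_cons, Finset.sum_range_succ, ← intSum_cons]
    have h4 : ∑ k ∈ Finset.range (i + 1), c k * ∑ n ∈ Finset.range (m + 1),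
          ((n : ℚ) + 1) ^ (-(s - (i + 1 - k : ℕ) : ℤ)) * intSum t n =
        ∑ k ∈ Finset.range (i + 1), c k * ∑ n ∈ Finset.range m,
          ((n : ℚ) + 1) ^ (-(s - (i + 1 - k : ℕ) : ℤ)) * intSum t n +
        (∑ k ∈ Finset.range (i + 1), c k * ((m : ℚ) + 1) ^ (i + 1 - k)) *
          (((m : ℚ) + 1) ^ (-s) * intSum t m) := by
      rw [Finset.sum_mul, ← Finset.sum_add_distrib]
      refine Finset.sum_congr rfl fun k _ => ?_
      rw [Finset.sum_range_succ, h1]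
      ring
    rw [Finset.sum_range_succ, Finset.sum_range_succ _ m, ihm, h3, h4, ← h2]
    ring

theorem sumOp_comp_mem_polyCompSpan (t : List ℕ+) (e : ℤ) :
    sumOp (powWeight e) (intSum (compList t)) ∈ polyCompSpan := by
  rcases lt_or_ge 0 e with he | he
  · exact sumOp_comp_mem_polyCompSpan_of_pos t he
  obtain ⟨i, rfl⟩ : ∃ i : ℕ, e = -i := ⟨(-e).toNat, by omega⟩
  obtain ⟨c, hc⟩ := exists_sum_pow_eq i
  -- Abel summation shortens the list but may produce another nonpositive exponent, so `i` has to
  -- vary.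
  induction t generalizing i c with
  | nil =>
    have h : sumOp (powWeight (-i)) (intSum (compList [])) =
        ∑ k ∈ Finset.range (i + 1), c k •
          fun m : ℕ => (m : ℚ) ^ (i + 1 - k) * intSum (compList []) m := by
      ext m
      simp only [sumOp_apply, powWeight, compList_nil, intSum_nil, mul_one,
        Finset.sum_apply, Pi.smul_apply, smul_eq_mul]
      rw [← hc]
      refine Finset.sum_congr rfl fun n _ => ?_
      rw [neg_neg, zpow_natCast]
    rw [h]
    exact sum_mem fun k _ => Submodule.smul_mem _ _ (mem_polyCompSpan _ _)
  | cons s t ih =>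
    rw [compList_cons, summation_by_parts i c hc]
    refine sub_mem (sum_mem fun k _ => Submodule.smul_mem _ _ (mem_polyCompSpan _ (s :: t)))
      (sum_mem fun k _ => Submodule.smul_mem _ _ ?_)
    rcases lt_or_ge 0 (((s : ℕ) : ℤ) - (i + 1 - k : ℕ)) with hs | hs
    · exact sumOp_comp_mem_polyCompSpan_of_pos t hs
    · obtain ⟨i', hi'⟩ : ∃ i' : ℕ, ((s : ℕ) : ℤ) - (i + 1 - k : ℕ) = -i' :=
        ⟨(-(((s : ℕ) : ℤ) - (i + 1 - k : ℕ))).toNat, by omega⟩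
      obtain ⟨c', hc'⟩ := exists_sum_pow_eq i'
      rw [hi']
      exact ih i' (by omega) c' hc'

theorem sumOp_mem_polyCompSpan (e : ℤ) {Φ : ℕ → ℚ} (h : Φ ∈ polyCompSpan) :
    sumOp (powWeight e) Φ ∈ polyCompSpan := by
  refine map_mem_of_mem_span _ ?_ h
  rintro _ ⟨⟨j, t⟩, rfl⟩
  induction j generalizing e with
  | zero => simpa using sumOp_comp_mem_polyCompSpan t e
  | succ j ih =>
    -- One factor `n` is written as `(n + 1) - 1`, and `n + 1` is absorbed into the weight.
    convert sub_mem (ih (e - 1)) (ih e) using 1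
    ext m
    simp only [sumOp_apply, Pi.sub_apply, ← Finset.sum_sub_distrib, powWeight]
    refine Finset.sum_congr rfl fun n _ => ?_
    have h0 : ((n : ℚ) + 1) ≠ 0 := by positivity
    rw [show -(e - 1) = -e + 1 by ring, zpow_add_one₀ h0]
    ring

theorem intSum_mem_polyCompSpan (t : List ℤ) : intSum t ∈ polyCompSpan := by
  induction t with
  | nil => simpa [compList] using mem_polyCompSpan 0 []
  | cons s t ih =>
    rw [intSum_cons_eq]
    exact sumOp_mem_polyCompSpan s ih

/-! ### Valuations of nested sums -/

theorem ratValGE_zpow_of_lt {p : Nat.Primes} {D n : ℕ} (hn : n ≠ 0) (hD : n < (p : ℕ) ^ (D + 1))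
    (s : ℤ) : RatValGE p (-(D * max s 0)) ((n : ℚ) ^ (-s)) := by
  obtain ⟨v, u, hu, rfl⟩ := Nat.exists_eq_pow_mul_and_not_dvd hn (p : ℕ) p.2.ne_one
  have hv : v ≤ D := by
    by_contra h
    have h1 : (p : ℕ) ^ (D + 1) ≤ (p : ℕ) ^ v := Nat.pow_le_pow_right p.2.pos (by omega)
    have h2 : 0 < u := Nat.pos_of_ne_zero (by rintro rfl; simp at hu)
    exact absurd (hD.trans_le (h1.trans (Nat.le_mul_of_pos_right _ h2))) (lt_irrefl _)
  have h := (RatValGE.prime_zpow p (v * -s)).mul ((RatUnit.of_nat hu).zpow (-s)).valGE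
  push_cast
  rw [mul_zpow, ← zpow_natCast, ← zpow_mul]
  refine h.mono ?_
  have hv' : (v : ℤ) ≤ D := by exact_mod_cast hv
  have h1 : (v : ℤ) * s ≤ v * max s 0 := mul_le_mul_of_nonneg_left (le_max_left _ _) (by positivity)
  have h2 : (v : ℤ) * max s 0 ≤ D * max s 0 := mul_le_mul_of_nonneg_right hv' (le_max_right _ _)
  linarith

/-- The sum of the positive parts of the exponents. -/
def posWeight (t : List ℤ) : ℤ := (t.map fun s => max s 0).sum

theorem posWeight_cons (s : ℤ) (t : List ℤ) : posWeight (s :: t) = max s 0 + posWeight t := by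
  simp [posWeight]

theorem ratValGE_intSum {p : Nat.Primes} {D N : ℕ} (hD : N < (p : ℕ) ^ (D + 1)) (t : List ℤ) :
    RatValGE p (-(D * posWeight t)) (intSum t N) := by
  induction t generalizing N with
  | nil => simpa [posWeight, intSum_nil] using RatValGE.one p
  | cons s t ih =>
    rw [intSum_cons]
    refine RatValGE.sum fun n hn => ?_
    have hn' := Finset.mem_range.1 hn
    have h := (ratValGE_zpow_of_lt (p := p) (D := D) (n := n + 1) (by omega) (by omega) s).mul
      (ih (N := n) (by omega))
    push_cast at h
    refine h.mono (le_of_eq ?_)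
    rw [posWeight_cons]
    ring

theorem integral_intSum_of_lt {p : Nat.Primes} {N : ℕ} (h : N < p) (t : List ℤ) :
    RatValGE p 0 (intSum t N) := by
  simpa using ratValGE_intSum (p := p) (D := 0) (N := N) (by simpa using h) t

open Polynomial

/-! ### The filtered algebra of rational sequences with an expansion -/

theorem mem_completion_congr {E : Type*} [AddCommGroup E] [Module ℚ E] {V B : ℤ → Submodule ℚ E}
    {c : ℤ} {x x' : E} (hx : x ∈ completion V B c) (h : ∀ n, x' - x ∈ V n) :
    x' ∈ completion V B c := by
  obtain ⟨y, hy, hxy⟩ := hx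
  refine ⟨y, hy, fun J => ?_⟩
  simpa using add_mem (h (c + J)) (hxy J)

/-- The span of the sequences `p ^ b H_{p-1}(t)` with `b ≥ n`. -/
def mhsBasic (n : ℤ) : Submodule ℚ (Nat.Primes → ℚ) :=
  Submodule.span ℚ {a | ∃ b : ℤ, n ≤ b ∧ ∃ t : List ℕ+,
    a = fun p : Nat.Primes => ((p : ℕ) : ℚ) ^ b * intSum (compList t) ((p : ℕ) - 1)}

/-- The rational sequences that have an expansion in terms `c p ^ b H_{p-1}(t)` with `b ≥ n`. -/
def mhsFil : ℤ → Submodule ℚ (Nat.Primes → ℚ) := completion seqFil mhsBasic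

theorem mhsBasic_le (n : ℤ) : mhsBasic n ≤ seqFil n := by
  refine Submodule.span_le.2 ?_
  rintro _ ⟨b, hb, t, rfl⟩
  refine mem_seqFil.2 (Eventually.of_forall fun p => ?_)
  have := (RatValGE.prime_zpow p b).mul
    (integral_intSum_of_lt (p := p) (N := (p : ℕ) - 1) (by have := p.2.pos; omega) (compList t))
  exact this.mono (by omega)

theorem mhsBasic_le_mhsFil (n : ℤ) : mhsBasic n ≤ mhsFil n := le_completion mhsBasic_le n

theorem mhsFil_le_seqFil (n : ℤ) : mhsFil n ≤ seqFil n := completion_le n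

theorem mhsFil_antitone : Antitone mhsFil := completion_antitone seqFil_antitone

theorem mhsFil_mono {m n : ℤ} {a : Nat.Primes → ℚ} (ha : a ∈ mhsFil n) (h : m ≤ n) :
    a ∈ mhsFil m := mhsFil_antitone h ha

theorem mhsFil_congr {n : ℤ} {a b : Nat.Primes → ℚ} (ha : a ∈ mhsFil n)
    (h : ∀ᶠ p in cofinite, b p = a p) : b ∈ mhsFil n := by
  refine mem_completion_congr ha fun m => ?_
  rw [mem_seqFil]
  filter_upwards [h] with p hp
  simpa [hp] using RatValGE.zero p m

theorem seqFil_mul {m n : ℤ} {a b : Nat.Primes → ℚ} (ha : a ∈ seqFil m) (hb : b ∈ seqFil n) :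
    a * b ∈ seqFil (m + n) := by
  rw [mem_seqFil] at *
  filter_upwards [ha, hb] with p h1 h2
  exact h1.mul h2

/-- The sequence `p ^ b Φ(p - 1)`, as a linear function of `Φ`. -/
def evalPred (b : ℤ) : (ℕ → ℚ) →ₗ[ℚ] (Nat.Primes → ℚ) where
  toFun Φ p := ((p : ℕ) : ℚ) ^ b * Φ ((p : ℕ) - 1)
  map_add' Φ Φ' := by
    ext p
    simp [mul_add]
  map_smul' c Φ := by
    ext p
    simp [mul_left_comm]

theorem evalPred_mem_mhsBasic {b n : ℤ} (hb : n ≤ b) {Φ : ℕ → ℚ} (hΦ : Φ ∈ compSpan) :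
    evalPred b Φ ∈ mhsBasic n := by
  refine map_mem_of_mem_span _ ?_ hΦ
  rintro _ ⟨t, rfl⟩
  exact Submodule.subset_span ⟨b, hb, t, rfl⟩

theorem mhsBasic_mul {m n : ℤ} {a b : Nat.Primes → ℚ} (ha : a ∈ mhsBasic m)
    (hb : b ∈ mhsBasic n) : a * b ∈ mhsBasic (m + n) := by
  refine map_mem_of_mem_span (LinearMap.mulRight ℚ b) ?_ ha
  rintro _ ⟨k, hk, t, rfl⟩
  refine map_mem_of_mem_span (LinearMap.mulLeft ℚ _) ?_ hb
  rintro _ ⟨k', hk', t', rfl⟩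
  have h := evalPred_mem_mhsBasic (b := k + k') (n := m + n) (by omega)
    (intSum_mul_mem_compSpan t t')
  convert h using 1
  ext p
  have hp : ((p : ℕ) : ℚ) ≠ 0 := by exact_mod_cast p.2.ne_zero
  simp only [LinearMap.mulLeft_apply, Pi.mul_apply, evalPred, LinearMap.coe_mk, AddHom.coe_mk,
    zpow_add₀ hp]
  ring

/-- Multiplication is extended from basic terms to expansions one factor at a time; on basic terms
it is the quasi-shuffle product. -/
theorem mhsFil_mul {m n : ℤ} {a b : Nat.Primes → ℚ} (ha : a ∈ mhsFil m) (hb : b ∈ mhsFil n) :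
    a * b ∈ mhsFil (m + n) := by
  refine map_mem_completion (LinearMap.mulRight ℚ b)
    (fun k x hx => seqFil_mul hx (mhsFil_le_seqFil _ hb)) (fun k x hx => ?_) ha
  rw [add_comm]
  refine map_mem_completion (LinearMap.mulLeft ℚ x)
    (fun l y hy => ?_) (fun l y hy => ?_) hb
  · rw [add_comm]
    exact seqFil_mul (mhsBasic_le _ hx) hy
  · rw [add_comm]
    exact mhsBasic_le_mhsFil _ (mhsBasic_mul hx hy)

theorem prime_zpow_mem_mhsFil (b : ℤ) : (fun p : Nat.Primes => ((p : ℕ) : ℚ) ^ b) ∈ mhsFil b := by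
  refine mhsBasic_le_mhsFil _ (Submodule.subset_span ⟨b, le_rfl, [], ?_⟩)
  simp [compList_nil, intSum_nil]

theorem one_mem_mhsFil : (1 : Nat.Primes → ℚ) ∈ mhsFil 0 := by
  simpa [Pi.one_def] using prime_zpow_mem_mhsFil 0

theorem const_mem_mhsFil (c : ℚ) : (fun _ : Nat.Primes => c) ∈ mhsFil 0 := by
  convert Submodule.smul_mem _ c one_mem_mhsFil using 1
  ext p
  simp

theorem mhsFil_zero_mul {n : ℤ} {a b : Nat.Primes → ℚ} (ha : a ∈ mhsFil 0) (hb : b ∈ mhsFil n) :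
    a * b ∈ mhsFil n := by
  simpa using mhsFil_mul ha hb

theorem mhsFil_zero_pow {a : Nat.Primes → ℚ} (ha : a ∈ mhsFil 0) (k : ℕ) :
    a ^ k ∈ mhsFil 0 := by
  induction k with
  | zero => simpa using one_mem_mhsFil
  | succ k ih =>
    rw [pow_succ]
    exact mhsFil_zero_mul ih ha

theorem polynomial_mem_mhsFil (q : ℤ[X]) :
    (fun p : Nat.Primes => ((q.eval ((p : ℕ) : ℤ) : ℤ) : ℚ)) ∈ mhsFil 0 := by
  induction q using Polynomial.induction_on' with
  | add q r hq hr =>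
    convert add_mem hq hr using 1
    ext p
    simp
  | monomial n c =>
    have h := mhsFil_zero_mul (const_mem_mhsFil c)
      (mhsFil_mono (prime_zpow_mem_mhsFil n) (by positivity : (0 : ℤ) ≤ n))
    convert h using 1
    ext p
    simp

theorem intSum_pred_mem_mhsFil (t : List ℤ) :
    (fun p : Nat.Primes => intSum t ((p : ℕ) - 1)) ∈ mhsFil 0 := by
  have key : ∀ Φ ∈ polyCompSpan, evalPred 0 Φ ∈ mhsFil 0 := by
    intro Φ hΦ
    refine map_mem_of_mem_span _ ?_ hΦ
    rintro _ ⟨⟨j, t⟩, rfl⟩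
    have h := mhsFil_zero_mul (mhsFil_zero_pow (polynomial_mem_mhsFil (X - 1)) j)
      (mhsBasic_le_mhsFil 0 (evalPred_mem_mhsBasic (le_refl 0) (intSum_mem_compSpan t)))
    convert h using 1
    ext p
    have hp := p.2.one_lt.le
    simp [evalPred, Nat.cast_sub hp]
  simpa [evalPred] using key _ (intSum_mem_polyCompSpan t)

/-! ### Powers of values of polynomials -/

theorem dvd_eval_iff (u : ℤ[X]) (p : ℤ) : p ∣ u.eval p ↔ p ∣ u.coeff 0 := by
  have h : u.eval p = p * u.divX.eval p + u.coeff 0 := by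
    conv_lhs => rw [← X_mul_divX_add u]
    simp
  rw [h]
  exact (Int.dvd_add_right (dvd_mul_right _ _))

theorem eventually_not_dvd_eval {u : ℤ[X]} (hu : u.coeff 0 ≠ 0) :
    ∀ᶠ p : Nat.Primes in cofinite, ¬ ((p : ℕ) : ℤ) ∣ u.eval ((p : ℕ) : ℤ) := by
  filter_upwards [eventually_not_dvd hu] with p hp
  rwa [dvd_eval_iff]

/-- With `u(p) = u(0) (1 - p w_p)`, the inverse is a geometric series in `p w_p`. The remainder
after `J` terms is `p ^ J w_p ^ J / u(p)`, and `u(p)` is a unit for almost all `p`. -/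
theorem eval_inv_mem_mhsFil {u : ℤ[X]} (hu : u.coeff 0 ≠ 0) :
    (fun p : Nat.Primes => ((u.eval ((p : ℕ) : ℤ) : ℤ) : ℚ)⁻¹) ∈ mhsFil 0 := by
  have hu0 : (u.coeff 0 : ℚ) ≠ 0 := by exact_mod_cast hu
  set v : Nat.Primes → ℚ := fun p => ((u.divX.eval ((p : ℕ) : ℤ) : ℤ) : ℚ) with hv
  have hvmem : v ∈ mhsFil 0 := polynomial_mem_mhsFil u.divX
  set w : Nat.Primes → ℚ := (fun _ => -(u.coeff 0 : ℚ)⁻¹) * v with hw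
  have hwmem : w ∈ mhsFil 0 := mhsFil_zero_mul (const_mem_mhsFil _) hvmem
  have hdecomp : ∀ p : Nat.Primes, ((u.eval ((p : ℕ) : ℤ) : ℤ) : ℚ) =
      u.coeff 0 * (1 - (p : ℕ) * w p) := by
    intro p
    have h : u.eval ((p : ℕ) : ℤ) = (p : ℕ) * u.divX.eval ((p : ℕ) : ℤ) + u.coeff 0 := by
      conv_lhs => rw [← X_mul_divX_add u]
      simp
    rw [h]
    simp only [hw, hv, Pi.mul_apply]
    push_cast
    field_simp
    ring
  refine mem_completion_of_series (fun j => (fun p : Nat.Primes => ((p : ℕ) : ℚ) ^ (j : ℤ)) *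
    ((fun _ => (u.coeff 0 : ℚ)⁻¹) * w ^ j)) (fun j => ?_) fun J => ?_
  · have h := mhsFil_mul (prime_zpow_mem_mhsFil j)
      (mhsFil_zero_mul (const_mem_mhsFil (u.coeff 0 : ℚ)⁻¹) (mhsFil_zero_pow hwmem j))
    rw [zero_add]
    rwa [add_zero] at h
  · rw [mem_seqFil]
    have hwv := mem_seqFil.1 (mhsFil_le_seqFil _ (mhsFil_zero_pow hwmem J))
    filter_upwards [eventually_not_dvd_eval hu, hwv] with p hp hwp
    have hunit := RatUnit.of_int hp
    have hne : 1 - ((p : ℕ) : ℚ) * w p ≠ 0 := by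
      intro h0
      refine hunit.ne_zero ?_
      rw [hdecomp, h0, mul_zero]
    have h1 : ((u.eval ((p : ℕ) : ℤ) : ℤ) : ℚ)⁻¹ -
        ∑ j ∈ Finset.range J, ((p : ℕ) : ℚ) ^ (j : ℤ) * ((u.coeff 0 : ℚ)⁻¹ * w p ^ j) =
        ((p : ℕ) : ℚ) ^ (J : ℤ) * (w p ^ J * ((u.eval ((p : ℕ) : ℤ) : ℤ) : ℚ)⁻¹) := by
      have h2 : ∑ j ∈ Finset.range J, ((p : ℕ) : ℚ) ^ (j : ℤ) * ((u.coeff 0 : ℚ)⁻¹ * w p ^ j) =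
          (u.coeff 0 : ℚ)⁻¹ * ∑ j ∈ Finset.range J, (((p : ℕ) : ℚ) * w p) ^ j := by
        rw [Finset.mul_sum]
        refine Finset.sum_congr rfl fun j _ => ?_
        rw [zpow_natCast, mul_pow]
        ring
      have h3 := mul_neg_geom_sum (((p : ℕ) : ℚ) * w p) J
      rw [h2, hdecomp, zpow_natCast]
      field_simp
      rw [mul_pow] at h3
      linear_combination -h3
    simp only [Pi.sub_apply, Finset.sum_apply, Pi.mul_apply, Pi.pow_apply]
    rw [h1]
    have h4 := (RatValGE.prime_zpow p J).mul (hwp.mul hunit.inv.valGE)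
    simpa using h4

theorem eval_zpow_mem_mhsFil {u : ℤ[X]} (hu : u.coeff 0 ≠ 0) (s : ℤ) :
    (fun p : Nat.Primes => ((u.eval ((p : ℕ) : ℤ) : ℤ) : ℚ) ^ s) ∈ mhsFil 0 := by
  rcases Int.eq_nat_or_neg s with ⟨k, rfl | rfl⟩
  · simpa [Pi.pow_def] using mhsFil_zero_pow (polynomial_mem_mhsFil u) k
  · simpa [Pi.pow_def] using mhsFil_zero_pow (eval_inv_mem_mhsFil hu) k

theorem exists_eq_X_pow_mul {q : ℤ[X]} (hq : q ≠ 0) :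
    ∃ (e : ℕ) (u : ℤ[X]), q = X ^ e * u ∧ u.coeff 0 ≠ 0 := by
  obtain ⟨u, h, hu⟩ := exists_eq_pow_rootMultiplicity_mul_and_not_dvd q hq 0
  rw [map_zero, sub_zero] at h hu
  exact ⟨_, u, h, fun h0 => hu (X_dvd_iff.2 h0)⟩

/-- Only the factor `X ^ e` of `q` creates a pole, and `e ≤ natDegree q`. -/
theorem eval_zpow_neg_mem_mhsFil {q : ℤ[X]} (hq : q ≠ 0) {d : ℕ} (hd : q.natDegree ≤ d) (s : ℤ) :
    (fun p : Nat.Primes => ((q.eval ((p : ℕ) : ℤ) : ℤ) : ℚ) ^ (-s)) ∈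
      mhsFil (-(d * max s 0)) := by
  obtain ⟨e, u, rfl, hu⟩ := exists_eq_X_pow_mul hq
  have hu0 : u ≠ 0 := by
    rintro rfl
    simp at hu
  have he : e ≤ d := by
    rw [natDegree_X_pow_mul e hu0] at hd
    omega
  have h := mhsFil_mul (prime_zpow_mem_mhsFil (e * -s)) (eval_zpow_mem_mhsFil hu (-s))
  have h1 : (e : ℤ) * s ≤ d * max s 0 :=
    (mul_le_mul_of_nonneg_left (le_max_left s 0) (by positivity)).trans
      (mul_le_mul_of_nonneg_right (by exact_mod_cast he) (le_max_right _ _))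
  convert mhsFil_mono h (show -(d * max s 0) ≤ (e : ℤ) * -s + 0 by linarith) using 1
  ext p
  simp [mul_zpow, zpow_mul]
  exact mul_comm _ _

/-! ### Letters -/

/-- A letter is an exponent `s` with a flag. Its value at `n` is `n ^ (-s)`, except that a flagged
letter vanishes at the multiples of `p`. -/
def letter (p : Nat.Primes) (x : ℤ × Bool) (n : ℕ) : ℚ :=
  if x.2 = true ∧ (p : ℕ) ∣ n then 0 else (n : ℚ) ^ (-x.1)

/-- The pole order of a letter along numbers of `p`-adic valuation at most `d`. -/
def letterWeight (d : ℕ) (x : ℤ × Bool) : ℤ := if x.2 = true then 0 else d * max x.1 0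

theorem letterWeight_nonneg (d : ℕ) (x : ℤ × Bool) : 0 ≤ letterWeight d x := by
  unfold letterWeight
  split_ifs
  · exact le_rfl
  · positivity

theorem letter_eval_mem_mhsFil {q : ℤ[X]} (hq : q ≠ 0) {d : ℕ} (hd : q.natDegree ≤ d)
    (hpos : ∀ᶠ p : Nat.Primes in cofinite, 0 ≤ q.eval ((p : ℕ) : ℤ)) (x : ℤ × Bool) :
    (fun p : Nat.Primes => letter p x (natEval q p)) ∈ mhsFil (-(letterWeight d x)) := by
  obtain ⟨s, b⟩ := x
  have hcast : ∀ᶠ p : Nat.Primes in cofinite,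
      ((natEval q p : ℕ) : ℤ) = q.eval ((p : ℕ) : ℤ) := by
    filter_upwards [hpos] with p hp
    exact Int.toNat_of_nonneg hp
  rcases b with _ | _
  · refine mhsFil_congr (a := fun p => ((q.eval ((p : ℕ) : ℤ) : ℤ) : ℚ) ^ (-s)) ?_ ?_
    · simpa [letterWeight] using eval_zpow_neg_mem_mhsFil hq hd s
    · filter_upwards [hcast] with p hp
      rw [← hp]
      simp [letter]
  · rw [show letterWeight d (s, true) = 0 by simp [letterWeight], neg_zero]
    -- As `q(p) ≡ q(0)` modulo `p`, a flagged letter at `q(p)` either vanishes or, for almost all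
    -- `p`, is a power of a unit.
    by_cases h0 : q.coeff 0 = 0
    · refine mhsFil_congr (zero_mem _) ?_
      filter_upwards [hcast] with p hp
      have : (p : ℕ) ∣ natEval q p := by
        rw [← Int.natCast_dvd_natCast, hp, dvd_eval_iff, h0]
        exact dvd_zero _
      simp [letter, this]
    · refine mhsFil_congr (eval_zpow_mem_mhsFil h0 (-s)) ?_
      filter_upwards [hcast, eventually_not_dvd_eval h0] with p hp hp'
      rw [← hp, Int.natCast_dvd_natCast] at hp'
      rw [← hp]
      simp [letter, hp']

theorem eventually_eval_pos {q : ℤ[X]} (hq : 0 < q.leadingCoeff) :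
    ∀ᶠ p : Nat.Primes in cofinite, 0 < q.eval ((p : ℕ) : ℤ) := by
  rcases Nat.eq_zero_or_pos q.natDegree with h0 | h0
  · refine Eventually.of_forall fun p => ?_
    rw [eq_C_of_natDegree_eq_zero h0, eval_C]
    rwa [leadingCoeff, h0] at hq
  · have h1 : Tendsto (fun x : ℝ => (q.map (Int.castRingHom ℝ)).eval x) atTop atTop := by
      refine tendsto_atTop_of_leadingCoeff_nonneg _ ?_ ?_
      · rw [degree_map_eq_of_injective
          (Int.cast_injective : Function.Injective (Int.castRingHom ℝ))]
        exact natDegree_pos_iff_degree_pos.1 h0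
      · rw [leadingCoeff_map_of_injective
          (Int.cast_injective : Function.Injective (Int.castRingHom ℝ))]
        simpa using hq.le
    have h2 : Tendsto (fun p : Nat.Primes => ((p : ℕ) : ℝ)) cofinite atTop := by
      refine tendsto_natCast_atTop_atTop.comp ?_
      rw [← Nat.cofinite_eq_atTop]
      exact Subtype.val_injective.tendsto_cofinite
    filter_upwards [(h1.comp h2).eventually_gt_atTop 0] with p hp
    simp only [Function.comp_apply] at hp
    have h3 : (q.map (Int.castRingHom ℝ)).eval ((p : ℕ) : ℝ) =
        ((q.eval ((p : ℕ) : ℤ) : ℤ) : ℝ) := by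
      simp
    rw [h3] at hp
    exact_mod_cast hp

/-! ### The binomial expansion -/

/-- By Pascal's rule the remainders satisfy `R(a + 1) = (1 + x) R(a) + choose(a, J) x ^ (J + 1)`
when the terms up to `x ^ J` are kept. Since `1 + x` is a unit, the bound propagates from `a = 0` in
both directions. -/
theorem binomial_remainder {p : Nat.Primes} {x : ℚ} (hx : RatValGE p 1 x)
    (hu : RatUnit p (1 + x)) (a : ℤ) (J : ℕ) :
    RatValGE p J ((1 + x) ^ a - ∑ j ∈ Finset.range J, ((Ring.choose a j : ℤ) : ℚ) * x ^ j) := by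
  rcases J with _ | J
  · simpa using (hu.zpow a).valGE
  have hxJ : RatValGE p ((J + 1 : ℕ) : ℤ) (x ^ (J + 1)) := by simpa using hx.pow (J + 1)
  have pascal : ∀ a : ℤ, (1 + x) ^ (a + 1) -
        ∑ j ∈ Finset.range (J + 1), ((Ring.choose (a + 1) j : ℤ) : ℚ) * x ^ j =
      (1 + x) * ((1 + x) ^ a - ∑ j ∈ Finset.range (J + 1), ((Ring.choose a j : ℤ) : ℚ) * x ^ j) +
        ((Ring.choose a J : ℤ) : ℚ) * x ^ (J + 1) := by
    intro a
    rw [zpow_add_one₀ hu.ne_zero]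
    have h : ∑ j ∈ Finset.range (J + 1), ((Ring.choose (a + 1) j : ℤ) : ℚ) * x ^ j =
        (1 + x) * ∑ j ∈ Finset.range (J + 1), ((Ring.choose a j : ℤ) : ℚ) * x ^ j -
          ((Ring.choose a J : ℤ) : ℚ) * x ^ (J + 1) := by
      induction J with
      | zero => simp
      | succ J ih =>
        have hx' : RatValGE p ((J + 1 : ℕ) : ℤ) (x ^ (J + 1)) := by simpa using hx.pow (J + 1)
        rw [Finset.sum_range_succ, ih hx', Finset.sum_range_succ _ (J + 1),
          Ring.choose_succ_succ]
        push_cast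
        ring
    rw [h]
    ring
  induction a using Int.induction_on with
  | zero =>
    rw [Finset.sum_range_succ']
    simpa [Ring.choose_zero_succ] using RatValGE.zero p _
  | succ a ih =>
    rw [pascal]
    exact (hu.valGE.mul_of_integral ih).add ((RatValGE.int p _).mul_of_integral hxJ)
  | pred a ih =>
    have h := pascal (-a - 1)
    rw [sub_add_cancel] at h
    have h2 := eq_div_of_mul_eq hu.ne_zero ((mul_comm _ _).trans (eq_sub_of_add_eq h.symm))
    rw [h2, div_eq_inv_mul]
    exact hu.inv.valGE.mul_of_integral (ih.sub ((RatValGE.int p _).mul_of_integral hxJ))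

theorem add_zpow_remainder {p : Nat.Primes} {i m : ℕ} (hi : ¬ (p : ℕ) ∣ i) (a : ℤ) (J : ℕ) :
    RatValGE p J ((((p : ℕ) : ℚ) * m + i) ^ a - ∑ j ∈ Finset.range J,
      ((Ring.choose a j : ℤ) : ℚ) * (((p : ℕ) : ℚ) ^ (j : ℤ) * ((m : ℚ) ^ j * (i : ℚ) ^ (a - j)))) := by
  have hiu := RatUnit.of_nat hi
  have hi0 := hiu.ne_zero
  have hpm : ¬ (p : ℕ) ∣ (p : ℕ) * m + i := by
    rwa [Nat.dvd_add_right (dvd_mul_right _ _)]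
  have hpmu := RatUnit.of_nat hpm
  push_cast at hpmu
  set x : ℚ := ((p : ℕ) : ℚ) * m * (i : ℚ)⁻¹ with hx
  have hval : RatValGE p 1 x := by
    have h := ((RatValGE.prime_zpow p 1).mul (RatValGE.nat p m)).mul hiu.inv.valGE
    simpa using h
  have h1x : 1 + x = (((p : ℕ) : ℚ) * m + i) * (i : ℚ)⁻¹ := by
    rw [hx]
    field_simp
    ring
  have hunit : RatUnit p (1 + x) := by
    have h2 := hiu.inv
    unfold RatUnit at *
    rw [h1x, Rat.cast_mul, norm_mul, hpmu, h2, one_mul]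
  have h := (hiu.zpow a).valGE.mul_of_integral (binomial_remainder hval hunit a J)
  convert h using 1
  rw [mul_sub, ← mul_zpow, h1x, mul_left_comm, mul_inv_cancel₀ hi0, mul_one, Finset.mul_sum]
  congr 1
  refine Finset.sum_congr rfl fun j _ => ?_
  rw [hx, mul_pow, mul_pow, zpow_sub₀ hi0, zpow_natCast, zpow_natCast, inv_pow]
  ring

/-! ### Splitting the range of a nested sum -/

theorem chainSum_zero {w : List (ℕ → ℚ)} (hw : w ≠ []) : chainSum w 0 = 0 := by
  cases w with
  | nil => exact absurd rfl hw
  | cons φ w => simp [chainSum_cons]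

/-- The terms are sorted by the number `i` of indices above `M`; since indices decrease, these are
the first `i`. -/
theorem chainSum_add (w : List (ℕ → ℚ)) (M L : ℕ) :
    chainSum w (M + L) = ∑ i ∈ Finset.range (w.length + 1),
      chainSum ((w.take i).map fun φ n => φ (M + n)) L * chainSum (w.drop i) M := by
  induction w generalizing L with
  | nil => simp [chainSum]
  | cons φ w ih =>
    rw [chainSum_cons, Finset.sum_range_add, ← chainSum_cons, List.length_cons,
      Finset.sum_range_succ', add_comm]
    congr 1
    · simp only [List.take_succ_cons, List.map_cons, List.drop_succ_cons, chainSum_cons, ih,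
        Finset.sum_mul, Finset.mul_sum]
      rw [Finset.sum_comm]
      refine Finset.sum_congr rfl fun i _ => Finset.sum_congr rfl fun n _ => ?_
      rw [add_assoc]
      ring
    · simp [chainSum]

/-- The nested sum of a word over `N ≥ n₁ > ⋯ > nₖ ≥ 1`. -/
def wordSum (p : Nat.Primes) (w : List (ℤ × Bool)) (N : ℕ) : ℚ := chainSum (w.map (letter p)) N

/-- The nested sum of a word over `M + L ≥ n₁ > ⋯ > nₖ ≥ M + 1`. -/
def shiftedSum (p : Nat.Primes) (M : ℕ) (w : List (ℤ × Bool)) (L : ℕ) : ℚ :=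
  chainSum (w.map fun x n => letter p x (M + n)) L

theorem wordSum_nil (p : Nat.Primes) (N : ℕ) : wordSum p [] N = 1 := rfl

theorem shiftedSum_nil (p : Nat.Primes) (M L : ℕ) : shiftedSum p M [] L = 1 := rfl

theorem wordSum_cons_succ (p : Nat.Primes) (x : ℤ × Bool) (w : List (ℤ × Bool)) (N : ℕ) :
    wordSum p (x :: w) (N + 1) =
      wordSum p (x :: w) N + letter p x (N + 1) * wordSum p w N :=
  chainSum_cons_succ _ _ _

theorem shiftedSum_cons (p : Nat.Primes) (M : ℕ) (x : ℤ × Bool) (w : List (ℤ × Bool)) (L : ℕ) :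
    shiftedSum p M (x :: w) L =
      ∑ n ∈ Finset.range L, letter p x (M + (n + 1)) * shiftedSum p M w n := rfl

theorem wordSum_add (p : Nat.Primes) (w : List (ℤ × Bool)) (M L : ℕ) :
    wordSum p w (M + L) = ∑ i ∈ Finset.range (w.length + 1),
      shiftedSum p M (w.take i) L * wordSum p (w.drop i) M := by
  simp only [wordSum, chainSum_add, shiftedSum, List.length_map, ← List.map_take, List.map_map,
    ← List.map_drop, Function.comp_def]

theorem wordSum_unflagged (p : Nat.Primes) (t : List ℤ) (N : ℕ) :
    wordSum p (t.map fun s => (s, false)) N = intSum t N := by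
  rw [wordSum, intSum, List.map_map]
  congr 2

/-- The total pole order of a word. -/
def wordWeight (d : ℕ) (w : List (ℤ × Bool)) : ℤ := (w.map (letterWeight d)).sum

theorem wordWeight_cons (d : ℕ) (x : ℤ × Bool) (w : List (ℤ × Bool)) :
    wordWeight d (x :: w) = letterWeight d x + wordWeight d w := by
  simp [wordWeight]

theorem wordWeight_nonneg (d : ℕ) (w : List (ℤ × Bool)) : 0 ≤ wordWeight d w := by
  refine List.sum_nonneg fun y hy => ?_
  obtain ⟨x, -, rfl⟩ := List.mem_map.1 hy
  exact letterWeight_nonneg d x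

theorem wordWeight_take_add_drop (d i : ℕ) (w : List (ℤ × Bool)) :
    wordWeight d (w.take i) + wordWeight d (w.drop i) = wordWeight d w := by
  rw [wordWeight, wordWeight, wordWeight, ← List.sum_append, ← List.map_append,
    List.take_append_drop]

theorem wordWeight_unflagged (d : ℕ) (t : List ℤ) :
    wordWeight d (t.map fun s => (s, false)) = d * posWeight t := by
  induction t with
  | nil => simp [wordWeight, posWeight]
  | cons s t ih =>
    rw [List.map_cons, wordWeight_cons, posWeight_cons, ih]
    simp [letterWeight]
    ring

/-! ### Nested sums over one block of residues -/

/-- The pairs `(m, i)` with `i < p`, encoding the numbers `p m + i`. -/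
def residueSet (p : Nat.Primes) : Set (ℕ × ℕ) := {x | x.2 < (p : ℕ)}

/-- The span of the families `p ^ b m ^ j S_i(t)` with `b ≥ n`. -/
def residueBasic (n : ℤ) : Submodule ℚ (Nat.Primes → ℕ × ℕ → ℚ) :=
  Submodule.span ℚ {Φ | ∃ b : ℤ, n ≤ b ∧ ∃ (j : ℕ) (t : List ℤ),
    Φ = fun (p : Nat.Primes) (x : ℕ × ℕ) => ((p : ℕ) : ℚ) ^ b * ((x.1 : ℚ) ^ j * intSum t x.2)}

/-- Families over `(m, i)` with an expansion in terms `p ^ b m ^ j S_i(t)`. -/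
def residueFil : ℤ → Submodule ℚ (Nat.Primes → ℕ × ℕ → ℚ) :=
  completion (familyFil residueSet) residueBasic

theorem residueBasic_le (n : ℤ) : residueBasic n ≤ familyFil residueSet n := by
  refine Submodule.span_le.2 ?_
  rintro _ ⟨b, hb, j, t, rfl⟩
  refine mem_familyFil.2 (Eventually.of_forall fun p x hx => ?_)
  have h := (RatValGE.prime_zpow p b).mul
    (((RatValGE.nat p x.1).pow j).mul (integral_intSum_of_lt (p := p) (N := x.2) hx t))
  exact h.mono (by simpa using hb)

/-- Summation over the residue against a kernel. -/
def residueOp (ψ : Nat.Primes → ℕ → ℕ → ℚ) :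
    (Nat.Primes → ℕ × ℕ → ℚ) →ₗ[ℚ] (Nat.Primes → ℕ × ℕ → ℚ) where
  toFun Φ p x := ∑ i ∈ Finset.range x.2, ψ p x.1 i * Φ p (x.1, i)
  map_add' Φ Φ' := by
    ext p x
    simp [mul_add, Finset.sum_add_distrib]
  map_smul' c Φ := by
    ext p x
    simp [Finset.mul_sum, mul_left_comm]

theorem residueOp_apply (ψ : Nat.Primes → ℕ → ℕ → ℚ) (Φ : Nat.Primes → ℕ × ℕ → ℚ)
    (p : Nat.Primes) (x : ℕ × ℕ) :
    residueOp ψ Φ p x = ∑ i ∈ Finset.range x.2, ψ p x.1 i * Φ p (x.1, i) := rfl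

theorem residueOp_mem_familyFil {ψ : Nat.Primes → ℕ → ℕ → ℚ} {a : ℤ}
    (hψ : ∀ p : Nat.Primes, ∀ m i : ℕ, i + 1 < (p : ℕ) → RatValGE p a (ψ p m i)) {n : ℤ}
    {Φ : Nat.Primes → ℕ × ℕ → ℚ} (hΦ : Φ ∈ familyFil residueSet n) :
    residueOp ψ Φ ∈ familyFil residueSet (n + a) := by
  rw [mem_familyFil] at *
  filter_upwards [hΦ] with p h x hx
  rw [residueOp_apply]
  refine RatValGE.sum fun i hi => ?_
  have hi' := Finset.mem_range.1 hi
  have hx' : x.2 < (p : ℕ) := hx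
  rw [add_comm]
  exact (hψ p x.1 i (by omega)).mul (h (x.1, i) (show i < (p : ℕ) by omega))

theorem not_dvd_succ {p : Nat.Primes} {i : ℕ} (hi : i + 1 < (p : ℕ)) : ¬ (p : ℕ) ∣ i + 1 :=
  Nat.not_dvd_of_pos_of_lt (by omega) hi

/-- The binomial series in `p m / (i + 1)` turns the basic term `p ^ b m ^ j' S_i(t)` into terms `p
^ (b + j) m ^ (j' + j) S_i((s + j) :: t)`. Keeping `m` as a formal power makes the coefficients
independent of the block. -/
theorem residueOp_letter_mem (x : ℤ × Bool) {c : ℤ} {Φ : Nat.Primes → ℕ × ℕ → ℚ}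
    (hΦ : Φ ∈ residueFil c) :
    residueOp (fun p m i => letter p x ((p : ℕ) * m + (i + 1))) Φ ∈ residueFil c := by
  obtain ⟨s, b⟩ := x
  have hletter : ∀ (p : Nat.Primes) (m i : ℕ), i + 1 < (p : ℕ) →
      letter p (s, b) ((p : ℕ) * m + (i + 1)) =
        (((p : ℕ) : ℚ) * m + ((i + 1 : ℕ) : ℚ)) ^ (-s) := by
    intro p m i hi
    have h : ¬ (p : ℕ) ∣ (p : ℕ) * m + (i + 1) := by
      rw [Nat.dvd_add_right (dvd_mul_right _ _)]
      exact not_dvd_succ hi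
    simp [letter, h]
  rw [← add_zero c]
  refine map_mem_completion _ (fun n Ψ hΨ => residueOp_mem_familyFil (fun p m i hi => ?_) hΨ)
    (fun n Ψ hΨ => ?_) hΦ
  · rw [hletter p m i hi]
    simpa using add_zpow_remainder (m := m) (not_dvd_succ hi) (-s) 0
  · rw [add_zero]
    set ψ : ℕ → Nat.Primes → ℕ → ℕ → ℚ := fun j p m i =>
      ((Ring.choose (-s) j : ℤ) : ℚ) * (((p : ℕ) : ℚ) ^ (j : ℤ) *
        ((m : ℚ) ^ j * ((i + 1 : ℕ) : ℚ) ^ (-s - j))) with hψ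
    refine mem_completion_of_series (fun j => residueOp (ψ j) Ψ) (fun j => ?_) fun J => ?_
    · refine le_completion residueBasic_le _ (map_mem_of_mem_span _ ?_ hΨ)
      rintro _ ⟨b', hb', j', t, rfl⟩
      have hmem : (fun (p : Nat.Primes) (x : ℕ × ℕ) => ((p : ℕ) : ℚ) ^ (b' + j) *
          ((x.1 : ℚ) ^ (j' + j) * intSum ((s + j) :: t) x.2)) ∈ residueBasic (n + j) :=
        Submodule.subset_span ⟨b' + j, by omega, j' + j, (s + j) :: t, rfl⟩
      convert Submodule.smul_mem _ ((Ring.choose (-s) j : ℤ) : ℚ) hmem using 1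
      ext p x
      have hp : ((p : ℕ) : ℚ) ≠ 0 := by exact_mod_cast p.2.ne_zero
      simp only [residueOp_apply, Pi.smul_apply, smul_eq_mul, hψ, intSum_cons, Finset.mul_sum]
      refine Finset.sum_congr rfl fun i _ => ?_
      rw [zpow_add₀ hp, pow_add, neg_add, ← sub_eq_add_neg]
      push_cast
      ring
    · have h : residueOp (fun p m i => letter p (s, b) ((p : ℕ) * m + (i + 1))) Ψ -
          ∑ j ∈ Finset.range J, residueOp (ψ j) Ψ =
          residueOp (fun p m i => letter p (s, b) ((p : ℕ) * m + (i + 1)) -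
            ∑ j ∈ Finset.range J, ψ j p m i) Ψ := by
        ext p x
        simp only [Pi.sub_apply, Finset.sum_apply, residueOp_apply, sub_mul,
          Finset.sum_sub_distrib, Finset.sum_mul]
        rw [Finset.sum_comm]
      rw [h]
      refine residueOp_mem_familyFil (fun p m i hi => ?_) (residueBasic_le _ hΨ)
      rw [hletter p m i hi]
      exact add_zpow_remainder (not_dvd_succ hi) (-s) J

theorem shiftedSum_mem_residueFil (w : List (ℤ × Bool)) :
    (fun (p : Nat.Primes) (x : ℕ × ℕ) => shiftedSum p ((p : ℕ) * x.1) w x.2) ∈ residueFil 0 := by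
  induction w with
  | nil =>
    refine le_completion residueBasic_le _ (Submodule.subset_span ⟨0, le_rfl, 0, [], ?_⟩)
    simp [shiftedSum_nil, intSum_nil]
  | cons x w ih =>
    convert residueOp_letter_mem x ih using 1
    ext p y
    rw [residueOp_apply, shiftedSum_cons]

/-- The span of the families `C_p m ^ j` with `C ∈ Fil^n`. -/
def polyBasic (n : ℤ) : Submodule ℚ (Nat.Primes → ℕ → ℚ) :=
  Submodule.span ℚ {Φ | ∃ C ∈ mhsFil n, ∃ j : ℕ,
    Φ = fun (p : Nat.Primes) (m : ℕ) => C p * (m : ℚ) ^ j}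

/-- Families over `m` with an expansion in terms `C_p m ^ j`. -/
def polyFil : ℤ → Submodule ℚ (Nat.Primes → ℕ → ℚ) :=
  completion (familyFil fun _ => Set.univ) polyBasic

theorem polyBasic_le (n : ℤ) : polyBasic n ≤ familyFil (fun _ => Set.univ) n := by
  refine Submodule.span_le.2 ?_
  rintro _ ⟨C, hC, j, rfl⟩
  refine mem_familyFil.2 ?_
  filter_upwards [mem_seqFil.1 (mhsFil_le_seqFil _ hC)] with p hp m _
  simpa using hp.mul ((RatValGE.nat p m).pow j)

/-- Restriction of a family over `(m, i)` to `i = p - 1`. -/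
def evalResidue : (Nat.Primes → ℕ × ℕ → ℚ) →ₗ[ℚ] (Nat.Primes → ℕ → ℚ) where
  toFun Φ p m := Φ p (m, (p : ℕ) - 1)
  map_add' _ _ := rfl
  map_smul' _ _ := rfl

/-- This covers a block without its last number. At `i = p - 1` the factors `S_i(t)` become
coefficients in `mhsFil 0`, so only powers of `m` still depend on the block. -/
theorem shiftedSum_mem_polyFil (w : List (ℤ × Bool)) :
    (fun (p : Nat.Primes) (m : ℕ) => shiftedSum p ((p : ℕ) * m) w ((p : ℕ) - 1)) ∈
      polyFil 0 := by
  rw [← add_zero (0 : ℤ)]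
  refine map_mem_completion evalResidue (fun n Φ hΦ => ?_) (fun n Φ hΦ => ?_)
    (shiftedSum_mem_residueFil w)
  · rw [add_zero]
    rw [mem_familyFil] at *
    filter_upwards [hΦ] with p hp m _
    exact hp (m, (p : ℕ) - 1) (show (p : ℕ) - 1 < p by have := p.2.pos; omega)
  · rw [add_zero]
    refine le_completion polyBasic_le _ (map_mem_of_mem_span _ ?_ hΦ)
    rintro _ ⟨b, hb, j, t, rfl⟩
    refine Submodule.subset_span ⟨_, mhsFil_mono (mhsFil_mul (prime_zpow_mem_mhsFil b)
      (intSum_pred_mem_mhsFil t)) (by omega), j, ?_⟩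
    ext p m
    simp [evalResidue]
    ring

/-! ### Families of nested sums with a varying upper limit -/

/-- The span of the families `C_p S_m(t)` with `C ∈ Fil^a` and `a - D posWeight t ≥ n`. -/
def nestBasic (D : ℕ) (n : ℤ) : Submodule ℚ (Nat.Primes → ℕ → ℚ) :=
  Submodule.span ℚ {Φ | ∃ (a : ℤ) (C : Nat.Primes → ℚ) (t : List ℤ), C ∈ mhsFil a ∧
    n ≤ a - D * posWeight t ∧ Φ = fun (p : Nat.Primes) (m : ℕ) => C p * intSum t m}

/-- Families over `m ≤ N p` with an expansion in terms `C_p S_m(t)`. -/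
def nestFil (N : Nat.Primes → ℕ) (D : ℕ) : ℤ → Submodule ℚ (Nat.Primes → ℕ → ℚ) :=
  completion (familyFil fun p => {m | m ≤ N p}) (nestBasic D)

/-- The operator `Φ ↦ ∑_{m' < m} Φ(p, m')`. -/
def prefixSum : (Nat.Primes → ℕ → ℚ) →ₗ[ℚ] (Nat.Primes → ℕ → ℚ) where
  toFun Φ p m := ∑ k ∈ Finset.range m, Φ p k
  map_add' Φ Φ' := by
    ext p m
    simp [Finset.sum_add_distrib]
  map_smul' c Φ := by
    ext p m
    simp [Finset.mul_sum]

theorem prefixSum_apply (Φ : Nat.Primes → ℕ → ℚ) (p : Nat.Primes) (m : ℕ) :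
    prefixSum Φ p m = ∑ k ∈ Finset.range m, Φ p k := rfl

section Nest

variable {N : Nat.Primes → ℕ} {D : ℕ}

theorem nestFil_mono {m n : ℤ} {Φ : Nat.Primes → ℕ → ℚ} (hΦ : Φ ∈ nestFil N D n) (h : m ≤ n) :
    Φ ∈ nestFil N D m :=
  completion_antitone (familyFil_antitone _) h hΦ

theorem mul_mem_nestFil {a c : ℤ} {C : Nat.Primes → ℚ} (hC : C ∈ mhsFil a)
    {Φ : Nat.Primes → ℕ → ℚ} (hΦ : Φ ∈ nestFil N D c)
    (hBV : ∀ n, nestBasic D n ≤ familyFil (fun p => {m | m ≤ N p}) n) :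
    (fun (p : Nat.Primes) (_ : ℕ) => C p) * Φ ∈ nestFil N D (c + a) := by
  refine map_mem_completion (LinearMap.mulLeft ℚ (fun (p : Nat.Primes) (_ : ℕ) => C p))
    (fun n Ψ hΨ => ?_) (fun n Ψ hΨ => le_completion hBV _ (map_mem_of_mem_span _ ?_ hΨ)) hΦ
  · rw [mem_familyFil] at *
    filter_upwards [hΨ, mem_seqFil.1 (mhsFil_le_seqFil _ hC)] with p h1 h2 m hm
    rw [add_comm]
    exact h2.mul (h1 m hm)
  · rintro _ ⟨a', C', t, hC', hn, rfl⟩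
    refine Submodule.subset_span ⟨a + a', C * C', t, mhsFil_mul hC hC', by linarith, ?_⟩
    ext p m
    simp [mul_assoc]

theorem nestBasic_le
    (hN : ∀ᶠ p : Nat.Primes in cofinite, N p < (p : ℕ) ^ (D + 1))
    (n : ℤ) : nestBasic D n ≤ familyFil (fun p => {m | m ≤ N p}) n := by
  refine Submodule.span_le.2 ?_
  rintro _ ⟨a, C, t, hC, hn, rfl⟩
  refine mem_familyFil.2 ?_
  filter_upwards [mem_seqFil.1 (mhsFil_le_seqFil _ hC), hN] with p hp hNp m hm
  have hm' : m ≤ N p := hm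
  exact (hp.mul (ratValGE_intSum (p := p) (D := D) (N := m) (by omega) t)).mono (by linarith)

theorem prefixSum_pow_mem_familyFil
    (hN : ∀ᶠ p : Nat.Primes in cofinite, N p < (p : ℕ) ^ (D + 1))
    {n a : ℤ} {K Φ : Nat.Primes → ℕ → ℚ} (e : ℤ)
    (hK : K ∈ familyFil (fun _ => Set.univ) a)
    (hΦ : Φ ∈ familyFil (fun p => {m | m ≤ N p}) n) :
    prefixSum (K * ((fun _ => powWeight e) * Φ)) ∈
      familyFil (fun p => {m | m ≤ N p}) (a + (n - D * max e 0)) := by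
  rw [mem_familyFil] at *
  filter_upwards [hK, hΦ, hN] with p h1 h2 h3 m hm
  have hm' : m ≤ N p := hm
  rw [prefixSum_apply]
  refine RatValGE.sum fun k hk => ?_
  have hk' := Finset.mem_range.1 hk
  have h4 := ratValGE_zpow_of_lt (p := p) (D := D) (n := k + 1) (by omega) (by omega) e
  push_cast at h4
  have h5 := (h1 k (Set.mem_univ _)).mul (h4.mul (h2 k (show k ≤ N p by omega)))
  exact h5.mono (by linarith)

theorem prefixSum_pow_mem_nestFil
    (hN : ∀ᶠ p : Nat.Primes in cofinite, N p < (p : ℕ) ^ (D + 1))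
    {c : ℤ} {Φ : Nat.Primes → ℕ → ℚ} (hΦ : Φ ∈ nestFil N D c)
    (e : ℤ) : prefixSum ((fun _ => powWeight e) * Φ) ∈ nestFil N D (c - D * max e 0) := by
  rw [sub_eq_add_neg]
  refine map_mem_completion
    (prefixSum ∘ₗ LinearMap.mulLeft ℚ (fun _ : Nat.Primes => powWeight e))
    (fun n Ψ hΨ => ?_) (fun n Ψ hΨ =>
      le_completion (nestBasic_le hN) _ (map_mem_of_mem_span _ ?_ hΨ)) hΦ
  · have h1 : (1 : Nat.Primes → ℕ → ℚ) ∈ familyFil (fun _ => Set.univ) 0 :=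
      mem_familyFil.2 (Eventually.of_forall fun p m _ => RatValGE.one p)
    have := prefixSum_pow_mem_familyFil hN e h1 hΨ
    rwa [one_mul, zero_add, sub_eq_add_neg] at this
  · rintro _ ⟨a, C, t, hC, hn, rfl⟩
    refine Submodule.subset_span ⟨a, C, e :: t, hC, ?_, ?_⟩
    · rw [posWeight_cons]
      linarith
    · ext p m
      simp only [LinearMap.comp_apply, LinearMap.mulLeft_apply, prefixSum_apply, Pi.mul_apply,
        intSum_cons, Finset.mul_sum, powWeight]
      exact Finset.sum_congr rfl fun k _ => by ring

/-- Writing `m = (m + 1) - 1` lowers `j` while replacing `e` by `e - 1` or `e`, so the pole order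
does not grow. -/
theorem prefixSum_monomial_mem_nestFil
    (hN : ∀ᶠ p : Nat.Primes in cofinite, N p < (p : ℕ) ^ (D + 1))
    {c : ℤ} {Φ : Nat.Primes → ℕ → ℚ}
    (hΦ : Φ ∈ nestFil N D c) (e : ℤ) (j : ℕ) :
    prefixSum ((fun (_ : Nat.Primes) (m : ℕ) => (m : ℚ) ^ j) * ((fun _ => powWeight e) * Φ)) ∈
      nestFil N D (c - D * max e 0) := by
  induction j generalizing e with
  | zero =>
    convert prefixSum_pow_mem_nestFil hN hΦ e using 2
    ext p m
    simp
  | succ j ih =>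
    have hD : (D : ℤ) * max (e - 1) 0 ≤ D * max e 0 :=
      mul_le_mul_of_nonneg_left (max_le_max_right 0 (by omega)) (by positivity)
    convert sub_mem (nestFil_mono (ih (e - 1)) (by linarith)) (ih e) using 1
    rw [← map_sub]
    congr 1
    ext p m
    have h0 : ((m : ℚ) + 1) ≠ 0 := by positivity
    simp only [Pi.mul_apply, Pi.sub_apply, powWeight]
    rw [show -(e - 1) = -e + 1 by ring, zpow_add_one₀ h0]
    ring

/-- The expression is linear in `K`, so the expansion of `K` in terms `C_p m ^ j` reduces it to the
monomial case. -/
theorem prefixSum_polyFil_mem_nestFil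
    (hN : ∀ᶠ p : Nat.Primes in cofinite, N p < (p : ℕ) ^ (D + 1))
    {c : ℤ} {K Φ : Nat.Primes → ℕ → ℚ} (hK : K ∈ polyFil 0)
    (hΦ : Φ ∈ nestFil N D c) (e : ℤ) :
    prefixSum (K * ((fun _ => powWeight e) * Φ)) ∈ nestFil N D (c - D * max e 0) := by
  rw [← zero_add (c - D * max e 0)]
  refine map_mem_completion
    (prefixSum ∘ₗ LinearMap.mulRight ℚ ((fun _ : Nat.Primes => powWeight e) * Φ))
    (fun n Ψ hΨ => prefixSum_pow_mem_familyFil hN e hΨ (completion_le _ hΦ))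
    (fun n Ψ hΨ => map_mem_of_mem_span _ ?_ hΨ) hK
  rintro _ ⟨C, hC, j, rfl⟩
  have h := mul_mem_nestFil hC (prefixSum_monomial_mem_nestFil hN hΦ e j) (nestBasic_le hN)
  rw [add_comm n]
  change _ ∈ nestFil N D _
  convert h using 1
  ext p m
  simp only [LinearMap.comp_apply, LinearMap.mulRight_apply, prefixSum_apply, Pi.mul_apply,
    Finset.mul_sum]
  exact Finset.sum_congr rfl fun k _ => by ring

/-- The number `p (m + 1)` ends its block, so it can only be the largest index; a flagged letter
vanishes there. -/
theorem shiftedSum_block (p : Nat.Primes) (x : ℤ × Bool) (w : List (ℤ × Bool)) (m : ℕ) :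
    shiftedSum p ((p : ℕ) * m) (x :: w) p =
      shiftedSum p ((p : ℕ) * m) (x :: w) ((p : ℕ) - 1) +
        (if x.2 = true then 0 else ((p : ℕ) : ℚ) ^ (-x.1)) *
          (shiftedSum p ((p : ℕ) * m) w ((p : ℕ) - 1) * powWeight x.1 m) := by
  have hp : (p : ℕ) = ((p : ℕ) - 1) + 1 := by have := p.2.pos; omega
  have h1 : letter p x ((p : ℕ) * m + p) =
      (if x.2 = true then 0 else ((p : ℕ) : ℚ) ^ (-x.1)) * powWeight x.1 m := by
    have h2 : (p : ℕ) ∣ (p : ℕ) * m + p := ⟨m + 1, by ring⟩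
    unfold letter
    by_cases hx : x.2 = true
    · simp [hx, h2]
    · rw [if_neg (fun h => hx h.1), if_neg hx, powWeight, ← mul_zpow]
      push_cast
      ring_nf
  rw [mul_comm (shiftedSum p _ w _), ← mul_assoc, ← h1, shiftedSum_cons, shiftedSum_cons]
  generalize hr : (p : ℕ) - 1 = r at *
  rw [hp] at h1 ⊢
  rw [Finset.sum_range_succ]

/-- Here `m` indexes the block of the largest index and `i` counts the other indices in that block;
the remaining ones are at most `p m`. -/
theorem wordSum_mul_eq (x : ℤ × Bool) (w : List (ℤ × Bool)) :
    (fun (p : Nat.Primes) (m : ℕ) => wordSum p (x :: w) ((p : ℕ) * m)) =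
      ∑ i ∈ Finset.range (w.length + 1),
        prefixSum ((fun p m => shiftedSum p ((p : ℕ) * m) (x :: w.take i) p) *
          fun p m => wordSum p (w.drop i) ((p : ℕ) * m)) := by
  ext p m
  simp only [Finset.sum_apply, prefixSum_apply, Pi.mul_apply]
  induction m with
  | zero => simp [wordSum, chainSum_zero]
  | succ m ih =>
    rw [mul_add, mul_one, wordSum_add, List.length_cons, Finset.sum_range_succ']
    simp only [List.take_succ_cons, List.drop_succ_cons, List.take_zero, List.drop_zero,
      shiftedSum_nil, one_mul, ih, Finset.sum_range_succ _ m, Finset.sum_add_distrib]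
    ring

theorem wordSum_mem_nestFil
    (hN : ∀ᶠ p : Nat.Primes in cofinite, N p < (p : ℕ) ^ (D + 1))
    (w : List (ℤ × Bool)) :
    (fun (p : Nat.Primes) (m : ℕ) => wordSum p w ((p : ℕ) * m)) ∈
      nestFil N D (-(wordWeight (D + 1) w)) := by
  induction hl : w.length using Nat.strong_induction_on generalizing w with
  | _ l ih =>
  cases w with
  | nil =>
    refine le_completion (nestBasic_le hN) _
      (Submodule.subset_span ⟨0, 1, [], one_mem_mhsFil, ?_, ?_⟩)
    · simp [wordWeight, posWeight]
    · ext p m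
      simp [wordSum_nil, intSum_nil]
  | cons x w =>
    rw [wordSum_mul_eq]
    refine sum_mem fun i _ => ?_
    have hΦ := ih (w.drop i).length (by rw [← hl]; simp) (w.drop i) rfl
    have hwt := wordWeight_take_add_drop (D + 1) i w
    have hnn := wordWeight_nonneg (D + 1) (w.take i)
    have hx := letterWeight_nonneg (D + 1) x
    rw [wordWeight_cons]
    -- Largest index prime to `p`: the weight exponent is `0`, so no pole is added.
    have h1 := prefixSum_polyFil_mem_nestFil hN (shiftedSum_mem_polyFil (x :: w.take i)) hΦ 0
    have h2 : (fun (p : Nat.Primes) (_ : ℕ) => if x.2 = true then 0 else ((p : ℕ) : ℚ) ^ (-x.1)) *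
        prefixSum ((fun (p : Nat.Primes) (m : ℕ) =>
          shiftedSum p ((p : ℕ) * m) (w.take i) ((p : ℕ) - 1)) *
            ((fun _ => powWeight x.1) * fun p m => wordSum p (w.drop i) ((p : ℕ) * m))) ∈
        nestFil N D (-(letterWeight (D + 1) x + wordWeight (D + 1) w)) := by
      by_cases hb : x.2 = true
      · convert zero_mem (nestFil N D (-(letterWeight (D + 1) x + wordWeight (D + 1) w))) using 1
        ext p m
        simp [hb]
      · simp only [if_neg hb]
        refine nestFil_mono (mul_mem_nestFil (prime_zpow_mem_mhsFil (-x.1))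
          (prefixSum_polyFil_mem_nestFil hN (shiftedSum_mem_polyFil (w.take i)) hΦ x.1)
          (nestBasic_le hN)) ?_
        rw [letterWeight, if_neg hb]
        have := le_max_left x.1 0
        push_cast
        linarith
    convert add_mem (nestFil_mono h1
      (show -(letterWeight (D + 1) x + wordWeight (D + 1) w) ≤ _ by simp; linarith)) h2 using 1
    ext p m
    simp only [prefixSum_apply, Pi.mul_apply, Pi.add_apply, Finset.mul_sum,
      ← Finset.sum_add_distrib, shiftedSum_block]
    refine Finset.sum_congr rfl fun k _ => ?_
    simp only [powWeight, neg_zero, zpow_zero]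
    ring

/-- Specializing to `m = N p` turns the terms `C_p S_m(t)` into products covered by `hS`; this is
the inductive step in the degree. -/
theorem wordSum_mul_mem_mhsFil
    (hN : ∀ᶠ p : Nat.Primes in cofinite, N p < (p : ℕ) ^ (D + 1))
    (hS : ∀ t : List ℤ, (fun p => intSum t (N p)) ∈ mhsFil (-(D * posWeight t)))
    (w : List (ℤ × Bool)) :
    (fun p : Nat.Primes => wordSum p w ((p : ℕ) * N p)) ∈ mhsFil (-(wordWeight (D + 1) w)) := by
  rw [← add_zero (-(wordWeight (D + 1) w))]
  refine map_mem_completion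
    (L := ({ toFun := fun Φ p => Φ p (N p)
             map_add' := fun _ _ => rfl
             map_smul' := fun _ _ => rfl } :
      (Nat.Primes → ℕ → ℚ) →ₗ[ℚ] (Nat.Primes → ℚ)))
    (fun n Φ hΦ => ?_) (fun n Φ hΦ => map_mem_of_mem_span _ ?_ hΦ)
    (wordSum_mem_nestFil hN w)
  · rw [add_zero, mem_seqFil]
    rw [mem_familyFil] at hΦ
    filter_upwards [hΦ] with p hp
    exact hp _ (le_refl (N p))
  · rintro _ ⟨a, C, t, hC, hn, rfl⟩
    exact mhsFil_mono (mhsFil_mul hC (hS t)) (by linarith)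

end Nest

/-! ### Nested sums up to a polynomial in `p` -/

/-- All nested sums up to `q(p)` have expansions with pole order at most `d` per unit of weight. -/
def HasExpansions (d : ℕ) (q : ℤ[X]) : Prop :=
  ∀ w : List (ℤ × Bool),
    (fun p : Nat.Primes => wordSum p w (natEval q p)) ∈ mhsFil (-(wordWeight d w))

theorem natEval_add_one {q : ℤ[X]} {p : ℕ} (h : 0 ≤ q.eval (p : ℤ)) :
    natEval (q + 1) p = natEval q p + 1 := by
  simp only [natEval, eval_add, eval_one]
  omega

theorem letter_succ_mem {d : ℕ} {q : ℤ[X]} (hd : (q + 1).natDegree ≤ d)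
    (hpos : ∀ᶠ p : Nat.Primes in cofinite, 0 ≤ q.eval ((p : ℕ) : ℤ)) (x : ℤ × Bool) :
    (fun p : Nat.Primes => letter p x (natEval (q + 1) p)) ∈ mhsFil (-(letterWeight d x)) := by
  refine letter_eval_mem_mhsFil ?_ hd ?_ x
  · intro h0
    obtain ⟨p, hp⟩ := hpos.exists
    have := congrArg (eval ((p : ℕ) : ℤ)) h0
    simp only [eval_add, eval_one, eval_zero] at this
    omega
  · filter_upwards [hpos] with p hp
    simp only [eval_add, eval_one]
    omega

theorem HasExpansions.add_one {d : ℕ} {q : ℤ[X]} (h : HasExpansions d q)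
    (hd : (q + 1).natDegree ≤ d)
    (hpos : ∀ᶠ p : Nat.Primes in cofinite, 0 ≤ q.eval ((p : ℕ) : ℤ)) :
    HasExpansions d (q + 1) := by
  intro w
  cases w with
  | nil => simpa [wordSum_nil] using h []
  | cons x w =>
    have h1 := mhsFil_mul (letter_succ_mem hd hpos x) (h w)
    rw [← neg_add, ← wordWeight_cons] at h1
    refine mhsFil_congr (add_mem (h (x :: w)) h1) ?_
    filter_upwards [hpos] with p hp
    simp only [Pi.add_apply, Pi.mul_apply, natEval_add_one hp, wordSum_cons_succ]

theorem HasExpansions.of_add_one {d : ℕ} {q : ℤ[X]} (h : HasExpansions d (q + 1))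
    (hd : (q + 1).natDegree ≤ d)
    (hpos : ∀ᶠ p : Nat.Primes in cofinite, 0 ≤ q.eval ((p : ℕ) : ℤ)) :
    HasExpansions d q := by
  intro w
  induction w with
  | nil => simpa [wordSum_nil] using h []
  | cons x w ih =>
    have h1 := mhsFil_mul (letter_succ_mem hd hpos x) ih
    rw [← neg_add, ← wordWeight_cons] at h1
    refine mhsFil_congr (sub_mem (h (x :: w)) h1) ?_
    filter_upwards [hpos] with p hp
    simp only [Pi.sub_apply, Pi.mul_apply, natEval_add_one hp, wordSum_cons_succ]
    ring

/-- The constant is reached in unit steps, in either direction; each step changes the sum by one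
letter at a value of a polynomial. -/
theorem HasExpansions.add_C {d : ℕ} {q : ℤ[X]} (h : HasExpansions d q) (hd : q.natDegree ≤ d)
    (hpos : ∀ a : ℤ, ∀ᶠ p : Nat.Primes in cofinite, 0 ≤ (q + C a).eval ((p : ℕ) : ℤ)) (a : ℤ) :
    HasExpansions d (q + C a) := by
  have hdeg : ∀ a : ℤ, (q + C a).natDegree ≤ d := fun a => by rwa [natDegree_add_C]
  have hsucc : ∀ a : ℤ, q + C a + 1 = q + C (a + 1) := fun a => by
    rw [C_add, C_1, add_assoc]
  induction a using Int.induction_on with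
  | zero => simpa using h
  | succ a ih =>
    rw [← hsucc]
    exact ih.add_one (by rw [hsucc]; exact hdeg _) (hpos _)
  | pred a ih =>
    have h1 := hsucc (-a - 1)
    rw [sub_add_cancel] at h1
    rw [← h1] at ih
    exact ih.of_add_one (by rw [h1]; exact hdeg _) (hpos _)

theorem hasExpansions_C (a : ℕ) : HasExpansions 0 (C (a : ℤ)) := by
  induction a with
  | zero =>
    intro w
    cases w with
    | nil => simpa [wordSum_nil, wordWeight] using const_mem_mhsFil 1
    | cons x w =>
      convert zero_mem (mhsFil (-(wordWeight 0 (x :: w)))) using 1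
      ext p
      simp [natEval, wordSum, chainSum_zero]
  | succ a ih =>
    have h : C ((a + 1 : ℕ) : ℤ) = C (a : ℤ) + 1 := by simp
    rw [h]
    refine ih.add_one (by rw [← h, natDegree_C]) (Eventually.of_forall fun p => ?_)
    simp

theorem leadingCoeff_X_pow_sub_pos {q : ℤ[X]} {d : ℕ} (hd : q.natDegree < d) :
    0 < (X ^ d - q).leadingCoeff := by
  rw [leadingCoeff_sub_of_degree_lt, leadingCoeff_X_pow]
  · exact one_pos
  · rw [degree_X_pow]
    exact (degree_le_natDegree).trans_lt (by exact_mod_cast hd)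

theorem hasExpansions_X_mul {D : ℕ} {F : ℤ[X]} (h : HasExpansions D F) (hd : F.natDegree ≤ D) :
    HasExpansions (D + 1) (X * F) := by
  intro w
  have hN : ∀ᶠ p : Nat.Primes in cofinite, natEval F p < (p : ℕ) ^ (D + 1) := by
    filter_upwards [eventually_eval_pos (leadingCoeff_X_pow_sub_pos (Nat.lt_succ_of_le hd))] with p hp
    simp only [eval_sub, eval_pow, eval_X, sub_pos] at hp
    have : (0 : ℤ) < ((p : ℕ) : ℤ) ^ (D + 1) := by
      have := p.2.pos
      positivity
    rw [natEval]
    zify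
    rw [Int.toNat_eq_max, max_lt_iff]
    exact ⟨hp, this⟩
  have hS : ∀ t : List ℤ, (fun p : Nat.Primes => intSum t (natEval F p)) ∈
      mhsFil (-(D * posWeight t)) := by
    intro t
    simpa only [wordSum_unflagged, wordWeight_unflagged] using h (t.map fun s => (s, false))
  convert wordSum_mul_mem_mhsFil hN hS w using 3 with p
  rw [natEval, natEval, eval_mul, eval_X]
  rcases le_total 0 (F.eval ((p : ℕ) : ℤ)) with hz | hz
  · rw [Int.toNat_mul (by positivity) hz, Int.toNat_natCast]
  · rw [Int.toNat_of_nonpos hz, Int.toNat_of_nonpos, mul_zero]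
    exact mul_nonpos_of_nonneg_of_nonpos (by positivity) hz

theorem hasExpansions (d : ℕ) (q : ℤ[X]) (hd : q.natDegree = d) (hq : 0 < q.leadingCoeff) :
    HasExpansions d q := by
  induction d generalizing q with
  | zero =>
    rw [eq_C_of_natDegree_eq_zero hd] at hq ⊢
    rw [leadingCoeff_C] at hq
    obtain ⟨a, ha⟩ := Int.eq_ofNat_of_zero_le hq.le
    rw [ha]
    exact hasExpansions_C a
  | succ d ih =>
    have hF : q.divX.natDegree = d := by
      rw [natDegree_divX_eq_natDegree_tsub_one, hd]
      rfl
    have hX : (X * q.divX).natDegree = d + 1 := by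
      have h := natDegree_add_C (p := X * q.divX) (a := q.coeff 0)
      rw [X_mul_divX_add, hd] at h
      exact h.symm
    have hlead : q.divX.leadingCoeff = q.leadingCoeff := by
      rw [leadingCoeff, leadingCoeff, hF, hd, coeff_divX]
    have h := hasExpansions_X_mul (ih q.divX hF (by rwa [hlead])) hF.le
    have h2 := h.add_C hX.le (fun a => ?_) (q.coeff 0)
    · rwa [X_mul_divX_add] at h2
    · refine (eventually_eval_pos ?_).mono fun p hp => hp.le
      rw [leadingCoeff_add_of_degree_lt' ?_, leadingCoeff_mul, leadingCoeff_X, one_mul, hlead]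
      · exact hq
      · refine degree_C_le.trans_lt ?_
        rw [← natDegree_pos_iff_degree_pos, hX]
        omega

/-! ### Nested sums between two polynomials in `p` -/

theorem wordWeight_mono {d e : ℕ} (h : d ≤ e) (w : List (ℤ × Bool)) :
    wordWeight d w ≤ wordWeight e w := by
  refine List.sum_le_sum fun x _ => ?_
  unfold letterWeight
  split_ifs
  · exact le_rfl
  · exact mul_le_mul_of_nonneg_right (by exact_mod_cast h) (le_max_right _ _)

/-- Splitting the sum up to `N` at `M`, the term with all indices above `M` is the wanted one; every
other term involves a shorter word above `M`. -/
theorem shiftedSum_mem_mhsFil_of_le {d : ℕ} {N M : Nat.Primes → ℕ}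
    (hMN : ∀ᶠ p in cofinite, M p ≤ N p)
    (hN : ∀ w, (fun p => wordSum p w (N p)) ∈ mhsFil (-(wordWeight d w)))
    (hM : ∀ w, (fun p => wordSum p w (M p)) ∈ mhsFil (-(wordWeight d w)))
    (w : List (ℤ × Bool)) :
    (fun p => shiftedSum p (M p) w (N p - M p)) ∈ mhsFil (-(wordWeight d w)) := by
  induction hl : w.length using Nat.strong_induction_on generalizing w with
  | _ l ih =>
  have h : ∑ i ∈ Finset.range w.length,
      (fun p => shiftedSum p (M p) (w.take i) (N p - M p)) * (fun p => wordSum p (w.drop i) (M p)) ∈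
        mhsFil (-(wordWeight d w)) := by
    refine sum_mem fun i hi => ?_
    have hi' := Finset.mem_range.1 hi
    have hlen : (w.take i).length < l := by
      rw [List.length_take]
      omega
    have := mhsFil_mul (ih _ hlen (w.take i) rfl) (hM (w.drop i))
    rwa [← neg_add, wordWeight_take_add_drop] at this
  refine mhsFil_congr (sub_mem (hN w) h) ?_
  filter_upwards [hMN] with p hp
  have h1 := wordSum_add p w (M p) (N p - M p)
  rw [Nat.add_sub_cancel' hp, Finset.sum_range_succ, List.take_length, List.drop_length,
    wordSum_nil, mul_one] at h1
  simp only [Pi.sub_apply, Finset.sum_apply, Pi.mul_apply]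
  rw [h1]
  ring

theorem shiftedSum_polynomial_mem_mhsFil {f g : ℤ[X]} (hf : 0 < f.leadingCoeff)
    (hg : 0 < g.leadingCoeff) (w : List (ℤ × Bool)) :
    (fun p : Nat.Primes => shiftedSum p (natEval g p) w (natEval f p - natEval g p)) ∈
      mhsFil (-(wordWeight f.natDegree w)) := by
  -- Otherwise `f(p) < g(p)` for almost all `p` and the range is empty.
  by_cases h : 0 ≤ (f - g).leadingCoeff
  · have hdeg : g.natDegree ≤ f.natDegree := by
      by_contra hlt
      push Not at hlt
      have h1 : (f - g).leadingCoeff = -g.leadingCoeff := by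
        have h2 := leadingCoeff_sub_of_degree_lt (degree_lt_degree hlt)
        rw [← h2, ← leadingCoeff_neg, neg_sub]
      omega
    refine shiftedSum_mem_mhsFil_of_le ?_ (hasExpansions _ f rfl hf) (fun w => ?_) w
    · rcases h.lt_or_eq with h | h
      · filter_upwards [eventually_eval_pos h] with p hp
        rw [eval_sub] at hp
        exact Int.toNat_le_toNat (by omega)
      · rw [sub_eq_zero.1 (leadingCoeff_eq_zero.1 h.symm)]
        exact Eventually.of_forall fun p => le_rfl
    · exact mhsFil_mono (hasExpansions _ g rfl hg w) (neg_le_neg (wordWeight_mono hdeg w))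
  · have h1 : 0 < (g - f).leadingCoeff := by
      rw [← neg_sub, leadingCoeff_neg]
      omega
    have h2 : ∀ᶠ p : Nat.Primes in cofinite, natEval f p - natEval g p = 0 := by
      filter_upwards [eventually_eval_pos h1] with p hp
      rw [eval_sub] at hp
      exact Nat.sub_eq_zero_of_le (Int.toNat_le_toNat (by omega))
    cases w with
    | nil => simpa [shiftedSum_nil, wordWeight] using const_mem_mhsFil 1
    | cons x w =>
      refine mhsFil_congr (zero_mem _) ?_
      filter_upwards [h2] with p hp
      rw [hp]
      simp [shiftedSum_cons]

/-! ### Sums over decreasing tuples -/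

theorem sum_decreasing_eq_chainSum {k : ℕ} (φ : Fin k → ℕ → ℚ) (M N : ℕ) :
    ∑ n ∈ Fintype.piFinset (fun _ : Fin k => Finset.Icc (M + 1) N) with
        ∀ i j, i < j → n j < n i, ∏ i, φ i (n i) =
      chainSum ((List.ofFn φ).map fun φ n => φ (M + n)) (N - M) := by
  induction k generalizing N with
  | zero =>
    have : (Fintype.piFinset (fun _ : Fin 0 => Finset.Icc (M + 1) N)) = Finset.univ := by
      ext n
      simp
    rw [this]
    simp [chainSum]
  | succ k ih =>
    rw [List.ofFn_succ, List.map_cons, chainSum_cons]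
    have h : ∀ r ∈ Finset.range (N - M), φ 0 (M + (r + 1)) *
        chainSum ((List.ofFn fun i => φ (Fin.succ i)).map fun φ n => φ (M + n)) r =
        ∑ n ∈ Fintype.piFinset (fun _ : Fin k => Finset.Icc (M + 1) (M + r)) with
          ∀ i j, i < j → n j < n i, φ 0 (M + (r + 1)) * ∏ i, φ (Fin.succ i) (n i) := by
      intro r _
      rw [← Finset.mul_sum, ih (fun i => φ (Fin.succ i)) (M + r), Nat.add_sub_cancel_left]
    rw [Finset.sum_congr rfl h, Finset.sum_sigma']
    -- The largest index is `n 0 = M + (r + 1)`; the tail then lies in `[M + 1, M + r]`.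
    refine (Finset.sum_nbij' (fun x => Fin.cons (M + (x.1 + 1)) x.2)
      (fun n => ⟨n 0 - (M + 1), Fin.tail n⟩) ?_ ?_ ?_ ?_ ?_).symm
    · rintro ⟨r, n⟩ hx
      simp only [Finset.mem_sigma, Finset.mem_range, Finset.mem_filter, Fintype.mem_piFinset,
        Finset.mem_Icc] at hx ⊢
      obtain ⟨hr, hn, hlt⟩ := hx
      refine ⟨fun i => ?_, fun i j hij => ?_⟩
      · refine Fin.cases ?_ (fun i => ?_) i
        · simp only [Fin.cons_zero]
          omega
        · simp only [Fin.cons_succ]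
          have := hn i
          omega
      · induction j using Fin.cases with
        | zero => exact absurd hij (Fin.not_lt_zero i)
        | succ j =>
          induction i using Fin.cases with
          | zero =>
            simp only [Fin.cons_zero, Fin.cons_succ]
            have := hn j
            omega
          | succ i =>
            simp only [Fin.cons_succ]
            exact hlt i j (Fin.succ_lt_succ_iff.1 hij)
    · intro n hn
      simp only [Finset.mem_sigma, Finset.mem_range, Finset.mem_filter, Fintype.mem_piFinset,
        Finset.mem_Icc] at hn ⊢
      obtain ⟨hn, hlt⟩ := hn
      have h0 := hn 0
      refine ⟨by omega, fun i => ?_, fun i j hij => hlt _ _ (Fin.succ_lt_succ_iff.2 hij)⟩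
      have h1 := hn i.succ
      have h2 := hlt 0 i.succ (Fin.succ_pos i)
      simp only [Fin.tail]
      omega
    · rintro ⟨r, n⟩ hx
      simp only [Fin.cons_zero, Fin.tail_cons]
      congr 1
      omega
    · intro n hn
      simp only [Finset.mem_filter, Fintype.mem_piFinset, Finset.mem_Icc] at hn
      have h0 := hn.1 0
      have h1 : M + (n 0 - (M + 1) + 1) = n 0 := by omega
      simp only [h1, Fin.cons_self_tail]
    · rintro ⟨r, n⟩ hx
      simp [Fin.prod_univ_succ]

theorem powerSum_eq (p : Nat.Primes) {k : ℕ} (N M : ℕ) (s : Fin k → ℤ) :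
    powerSum N M s = shiftedSum p M (List.ofFn fun i => (s i, false)) (N - M) := by
  have h := sum_decreasing_eq_chainSum (fun i => letter p (s i, false)) M N
  rw [shiftedSum, List.map_ofFn]
  rw [List.map_ofFn] at h
  refine Eq.trans ?_ h
  refine Finset.sum_congr rfl fun n _ => ?_
  simp [letter, Finset.prod_inv_distrib]

theorem powerSumRestricted_eq (p : Nat.Primes) {k : ℕ} (N M : ℕ) (s : Fin k → ℤ) :
    powerSumRestricted p N M s = shiftedSum p M (List.ofFn fun i => (s i, true)) (N - M) := by
  have h := sum_decreasing_eq_chainSum (fun i => letter p (s i, true)) M N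
  rw [shiftedSum, List.map_ofFn]
  rw [List.map_ofFn] at h
  refine Eq.trans ?_ h
  rw [powerSumRestricted, ← Finset.filter_filter, Finset.sum_filter]
  refine Finset.sum_congr rfl fun n _ => ?_
  have hdvd := (Nat.prime_iff.1 p.2).dvd_finsetProd_iff (S := Finset.univ) n
  by_cases hd : (p : ℕ) ∣ ∏ i, n i
  · rw [if_neg (not_not.2 hd)]
    obtain ⟨i, hi, hdi⟩ := hdvd.1 hd
    refine (Finset.prod_eq_zero hi ?_).symm
    simp [letter, hdi]
  · rw [if_pos hd]
    have h1 : ∀ i, ¬ (p : ℕ) ∣ n i := fun i hi => hd (hdvd.2 ⟨i, Finset.mem_univ i, hi⟩)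
    simp [letter, h1, Finset.prod_inv_distrib]

theorem harmonicSum_eq (N : ℕ) (s : List ℕ+) : harmonicSum N s = intSum (compList s) N := by
  have h := sum_decreasing_eq_chainSum
    (fun (i : Fin s.length) (n : ℕ) => (n : ℚ) ^ (-((s.get i : ℕ) : ℤ))) 0 N
  rw [List.map_ofFn, Nat.sub_zero] at h
  have h2 : compList s = List.ofFn fun i => ((s.get i : ℕ) : ℤ) := by
    conv_lhs => rw [← List.ofFn_get s]
    rw [compList, List.map_ofFn]
    rfl
  rw [intSum, h2, List.map_ofFn]
  refine Eq.trans ?_ (h.trans ?_)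
  · refine Finset.sum_congr (by simp) fun n _ => ?_
    simp [Finset.prod_inv_distrib]
  · congr 2
    ext i n
    simp

/-! ### From rational sequences to the MHS algebra -/

/-- The finitely many exceptional primes are controlled by the crude bound `v_p(x) ≥ -x.den`. -/
theorem mem_boundedSeq_of_mem_seqFil {n : ℤ} {a : Nat.Primes → ℚ} (ha : a ∈ seqFil n) :
    (fun p : Nat.Primes => ((a p : ℚ) : ℚ_[p])) ∈ boundedSeq := by
  have hfin : {p : Nat.Primes | ¬ RatValGE p n (a p)}.Finite := mem_seqFil.1 ha
  obtain ⟨K, hK⟩ := (hfin.image fun p => (a p).den).bddAbove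
  refine ⟨min n (-(K : ℤ)), fun p => ?_⟩
  by_cases hp : RatValGE p n (a p)
  · exact hp.mono (min_le_left _ _)
  · refine (valGE_rat (a p) p).mono ((min_le_right _ _).trans (neg_le_neg ?_))
    exact_mod_cast hK ⟨p, hp, rfl⟩

/-- The sequence `c p ^ b H_{p-1}(s)`. -/
def mhsTerm (c : ℚ) (b : ℤ) (s : List ℕ+) (p : Nat.Primes) : ℚ :=
  c * (((p : ℕ) : ℚ) ^ b * intSum (compList s) ((p : ℕ) - 1))

theorem mhsTerm_mem_seqFil (c : ℚ) {b n : ℤ} (h : n ≤ b) (s : List ℕ+) :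
    mhsTerm c b s ∈ seqFil n :=
  mhsBasic_le n (Submodule.smul_mem _ c (Submodule.subset_span ⟨b, h, s, rfl⟩))

theorem exists_terms_of_mem_mhsBasic {n : ℤ} {y : Nat.Primes → ℚ} (hy : y ∈ mhsBasic n) :
    ∃ (l : ℕ) (c : ℕ → ℚ) (b : ℕ → ℤ) (s : ℕ → List ℕ+), (∀ i, n ≤ b i) ∧
      y = ∑ i ∈ Finset.range l, mhsTerm (c i) (b i) (s i) := by
  obtain ⟨l, c, g, rfl⟩ := Submodule.mem_span_set'.1 hy
  choose b hb s hs using fun i => (g i).2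
  refine ⟨l, fun i => if h : i < l then c ⟨i, h⟩ else 0, fun i => if h : i < l then b ⟨i, h⟩ else n,
    fun i => if h : i < l then s ⟨i, h⟩ else [], fun i => ?_, ?_⟩
  · dsimp only
    split_ifs with h
    · exact hb _
    · exact le_rfl
  · rw [Finset.sum_range]
    refine Finset.sum_congr rfl fun i _ => ?_
    simp only [i.2, dif_pos, Fin.eta]
    rw [hs i]
    rfl

theorem exists_series_of_mem_mhsFil {n : ℤ} {a : Nat.Primes → ℚ} (ha : a ∈ mhsFil n) :
    ∃ (c : ℕ → ℚ) (b : ℕ → ℤ) (s : ℕ → List ℕ+), (∀ i, n ≤ b i) ∧ Tendsto b atTop atTop ∧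
      ∀ k : ℤ, ∃ m₀ : ℕ, ∀ m ≥ m₀,
        a - ∑ i ∈ Finset.range m, mhsTerm (c i) (b i) (s i) ∈ seqFil k := by
  obtain ⟨y, hy, hay⟩ := ha
  choose l c b s hb hyeq using fun j => exists_terms_of_mem_mhsBasic (hy j)
  set c' : ℕ → ℚ := fun i =>
    if i.unpair.2 < l i.unpair.1 then c i.unpair.1 i.unpair.2 else 0 with hc'
  -- Codes of pairs that carry no term get coefficient `0`; their exponent `n + i` is chosen so that
  -- `b'` still tends to infinity.
  set b' : ℕ → ℤ := fun i =>
    if i.unpair.2 < l i.unpair.1 then b i.unpair.1 i.unpair.2 else n + i with hb'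
  set s' : ℕ → List ℕ+ := fun i =>
    if i.unpair.2 < l i.unpair.1 then s i.unpair.1 i.unpair.2 else [] with hs'
  have hb'ge : ∀ i, i.unpair.2 < l i.unpair.1 → n + i.unpair.1 ≤ b' i := by
    intro i h
    simp only [hb', if_pos h]
    exact hb _ _
  -- The codes of the terms of `y 0, …, y (J - 1)`. Outside this finite set a term is zero or has
  -- exponent at least `n + J`.
  set S : ℕ → Finset ℕ := fun J =>
    ((Finset.range J).sigma fun j => Finset.range (l j)).image fun x => Nat.pair x.1 x.2 with hS
  have hSmem : ∀ J i, i ∉ S J → i.unpair.2 < l i.unpair.1 → J ≤ i.unpair.1 := by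
    intro J i hi hl
    by_contra hJ
    push Not at hJ
    refine hi (Finset.mem_image.2 ⟨⟨i.unpair.1, i.unpair.2⟩, ?_, Nat.pair_unpair i⟩)
    simp [hJ, hl]
  refine ⟨c', b', s', fun i => ?_, ?_, fun k => ?_⟩
  · by_cases h : i.unpair.2 < l i.unpair.1
    · have := hb'ge i h
      omega
    · simp only [hb', if_neg h]
      omega
  · refine tendsto_atTop.2 fun K => ?_
    obtain ⟨m₀, hm₀⟩ := (S (K - n).toNat).exists_nat_subset_range
    filter_upwards [eventually_ge_atTop (max m₀ (K - n).toNat)] with i hi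
    have hi' : i ∉ S (K - n).toNat := fun h => by
      have := Finset.mem_range.1 (hm₀ h)
      omega
    by_cases h : i.unpair.2 < l i.unpair.1
    · have h1 := hb'ge i h
      have h2 := hSmem _ i hi' h
      omega
    · simp only [hb', if_neg h]
      omega
  · set J : ℕ := (k - n).toNat with hJ
    obtain ⟨m₀, hm₀⟩ := (S J).exists_nat_subset_range
    refine ⟨m₀, fun m hm => ?_⟩
    have hsub : S J ⊆ Finset.range m := hm₀.trans (Finset.range_subset_range.2 hm)
    have hsum : ∑ i ∈ S J, mhsTerm (c' i) (b' i) (s' i) = ∑ j ∈ Finset.range J, y j := by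
      rw [hS, Finset.sum_image, Finset.sum_sigma]
      · refine Finset.sum_congr rfl fun j _ => ?_
        rw [hyeq j]
        refine Finset.sum_congr rfl fun i hi => ?_
        simp only [hc', hb', hs', Nat.unpair_pair, Finset.mem_range.1 hi, if_pos]
      · rintro ⟨j, i⟩ _ ⟨j', i'⟩ _ h
        obtain ⟨rfl, rfl⟩ := Nat.pair_eq_pair.1 h
        rfl
    have h1 : a - ∑ i ∈ Finset.range m, mhsTerm (c' i) (b' i) (s' i) =
        (a - ∑ j ∈ Finset.range J, y j) -
          ∑ i ∈ Finset.range m \ S J, mhsTerm (c' i) (b' i) (s' i) := by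
      rw [← Finset.sum_sdiff hsub, hsum]
      abel
    rw [h1]
    refine sub_mem (seqFil_antitone (by omega) (hay J)) (sum_mem fun i hi => ?_)
    have hi' := (Finset.mem_sdiff.1 hi).2
    by_cases h : i.unpair.2 < l i.unpair.1
    · have h2 := hb'ge i h
      have h3 := hSmem _ i hi' h
      exact mhsTerm_mem_seqFil _ (by omega) _
    · convert zero_mem (seqFil k) using 1
      ext p
      simp [mhsTerm, hc', if_neg h]

theorem coe_term_apply (c : ℚ) (b : ℤ) (s : List ℕ+) (p : Nat.Primes) :
    (c • (pPow b * harmonicSeq s)).1 p = ((mhsTerm c b s p : ℚ) : ℚ_[p]) := by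
  have h : (c • (pPow b * harmonicSeq s)).1 p =
      c • ((((p : ℕ) : ℚ_[p]) ^ b) * ((harmonicSum ((p : ℕ) - 1) s : ℚ) : ℚ_[p])) := rfl
  rw [h, harmonicSum_eq, mhsTerm, Rat.smul_def]
  push_cast
  rfl

theorem classMem_filMHS {n : ℤ} {a : Nat.Primes → ℚ} (ha : a ∈ mhsFil n) :
    ClassMem a (filMHS n) := by
  refine ⟨mem_boundedSeq_of_mem_seqFil (mhsFil_le_seqFil _ ha), ?_⟩
  obtain ⟨c, b, s, hb, hlim, hconv⟩ := exists_series_of_mem_mhsFil ha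
  refine ⟨c, b, s, ⟨hlim, fun k => ?_⟩, hb⟩
  obtain ⟨m₀, hm₀⟩ := hconv k
  refine ⟨m₀, fun m hm => ?_⟩
  refine ⟨⟨_, mem_boundedSeq_of_mem_seqFil (mhsFil_le_seqFil _ ha)⟩ -
    ∑ i ∈ Finset.range m, c i • (pPow (b i) * harmonicSeq (s i)), ?_, ?_⟩
  · simp only [toQInf, map_sub, map_sum]
  · filter_upwards [mem_seqFil.1 (hm₀ m hm)] with p hp
    unfold RatValGE at hp
    convert hp using 1
    rw [AddSubgroupClass.coe_sub, AddSubmonoidClass.coe_finsetSum, Pi.sub_apply,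
      Finset.sum_apply]
    simp only [coe_term_apply, Pi.sub_apply, Finset.sum_apply, Rat.cast_sub, Rat.cast_sum]

theorem filMHS_subset_mhsAlgebra (n : ℤ) : filMHS n ⊆ mhsAlgebra := by
  rintro x ⟨c, b, s, h, -⟩
  exact ⟨c, b, s, h⟩

theorem ClassMem.mono {a : Nat.Primes → ℚ} {X Y : Set QInf} (h : ClassMem a X) (hXY : X ⊆ Y) :
    ClassMem a Y :=
  ⟨h.1, hXY h.2⟩

theorem wordWeight_ofFn_unflagged {k : ℕ} (d : ℕ) (s : Fin k → ℤ) :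
    wordWeight d (List.ofFn fun i => (s i, false)) = d * ∑ i, max (s i) 0 := by
  simp [wordWeight, List.map_ofFn, List.sum_ofFn, letterWeight, Finset.mul_sum]

theorem wordWeight_ofFn_flagged {k : ℕ} (d : ℕ) (s : Fin k → ℤ) :
    wordWeight d (List.ofFn fun i => (s i, true)) = 0 := by
  simp [wordWeight, List.map_ofFn, List.sum_ofFn, letterWeight]

end

end MHS

theorem mainTheorem1 :
    (∀ (k : ℕ) (s : Fin k → ℤ) (f g : Polynomial ℤ),
      0 < f.leadingCoeff → 0 < g.leadingCoeff →
        MHS.ClassMem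
            (fun p : Nat.Primes => MHS.powerSum (MHS.natEval f p) (MHS.natEval g p) s)
            (MHS.filMHS (-((f.natDegree : ℤ) * ∑ i, max (s i) 0))) ∧
          MHS.ClassMem
            (fun p : Nat.Primes =>
              MHS.powerSumRestricted p (MHS.natEval f p) (MHS.natEval g p) s)
            (MHS.filMHS 0)) ∧
      ∀ (f : Polynomial ℤ) (s : List ℕ+), 0 < f.leadingCoeff →
        MHS.ClassMem (fun p : Nat.Primes => MHS.harmonicSum (MHS.natEval f p) s)
          MHS.mhsAlgebra := by
  refine ⟨fun k s f g hf hg => ⟨?_, ?_⟩, fun f s hf => ?_⟩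
  · refine MHS.classMem_filMHS ?_
    have h := MHS.shiftedSum_polynomial_mem_mhsFil hf hg (List.ofFn fun i => (s i, false))
    rw [MHS.wordWeight_ofFn_unflagged] at h
    convert h using 2 with p
    exact MHS.powerSum_eq p _ _ s
  · refine MHS.classMem_filMHS ?_
    have h := MHS.shiftedSum_polynomial_mem_mhsFil hf hg (List.ofFn fun i => (s i, true))
    rw [MHS.wordWeight_ofFn_flagged, neg_zero] at h
    convert h using 2 with p
    exact MHS.powerSumRestricted_eq p _ _ s
  · refine MHS.ClassMem.mono (MHS.classMem_filMHS ?_) (MHS.filMHS_subset_mhsAlgebra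
      (-(MHS.wordWeight f.natDegree ((MHS.compList s).map fun s => (s, false)))))
    convert MHS.hasExpansions _ f rfl hf ((MHS.compList s).map fun s => (s, false)) using 2 with p
    rw [MHS.wordSum_unflagged, MHS.harmonicSum_eq]
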